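/- **Conventions.** Let $R_z(t),R_y(t)\in SO(3)$ be the rotations by the angle $t$ about the $z$- and $y$-axis, and $R(\alpha,\beta,\gamma)=R_z(\alpha)R_y(\beta)R_z(\gamma)$ for $\alpha,\beta,\gamma\in\mathbb R$. For $n\ge 0$ and integers $|k|,|l|\le n$, the Wigner-d function is $$d_n^{k,l}(x)=(-1)^{\nu}\binom{2n-s}{s+a}^{1/2}\binom{s+b}{b}^{-1/2}\Big(\tfrac{1-x}{2}\Big)^{a/2}\Big(\tfrac{1+x}{2}\Big)^{b/2}P_s^{(a,b)}(x),\qquad x\in[-1,1],$$ where $a=|k-l|$, $b=|k+l|$, $s=n-\max(|k|,|l|)$, $\nu=k+l$ if $k>l$ and $\nu=0$ otherwise, and $P_s^{(a,b)}$ is the Jacobi polynomial. The Wigner-D function $D_n^{k,l}:SO(3)\to\mathbb C$ is given by $D_n^{k,l}(R(\alpha,\beta,\gamma))=\sqrt{2n+1}\,e^{-ik\alpha}\,d_n^{k,l}(\cos\beta)\,e^{-il\gamma}$ for $\beta\in[0,\pi]$. For $r\ge1$ let $C_r=\{R_z(2\pi s/r): s=0,\dots,r-1\}$ and $D_r=\{c\,R_y(\pi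 s): c\in C_r,\ s\in\{0,1\}\}$. **Theorem.** Let $N\in\mathbb N$, and let $$f=\sum_{n=0}^N\sum_{k,l=-n}^n\hat f_n^{k,l}D_n^{k,l}$$ be an $N$-band-limited function on $SO(3)$ with harmonic coefficients $\hat f_n^{k,l}\in\mathbb C$, $(n,k,l)\in J_N=\{(n,k,l): 0\le n\le N,\ |k|,|l|\le n\}$. Let $$S_R=\{s\in SO(3): f(sR)=f(R)\ \text{for all } R\in SO(3)\},\qquad S_L=\{s\in SO(3): f(Rs)=f(R)\ \text{for all } R\in SO(3)\}$$ be its right and left symmetry groups, i.e. the largest subgroups for which $f(s_R R s_L)=f(R)$ for all $s_R\in S_R$, $s_L\in S_L$, $R\in SO(3)$. For $k,j,l\in\{-N,\dots,N\}$ put $$\hat g_{k,j,l}=i^{k-l}\sum_{n=\max(|k|,|l|,|j|)}^N\sqrt{2n+1}\;d_n^{j,k}(0)\,d_n^{j,l}(0)\,\hat f_n^{-k,-l}.$$ These are the Fourier coefficients of the DFS transform of $f$: for all $\alpha,\beta,\gamma\in\mathbb R$, $f(R(\alpha,\beta,\gamma))=\sum_{k,j,l=-N}^N\hat g_{k,j,l}\,e^{i(k\alpha+j\beta+l\gamma)}$.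 Moreover, for every integer $r\ge1$: a) The following are equivalent: (i) $C_r\subseteq S_R$; (ii) $\hat f_n^{k,l}=0$ for all $(n,k,l)\in J_N$ with $r\nmid k$; (iii) $\hat g_{k,j,l}=0$ for all $k,j,l\in\{-N,\dots,N\}$ with $r\nmid k$. b) The following are equivalent: (i) $D_r\subseteq S_R$; (ii) property a)(ii), and $\hat f_n^{k,l}=(-1)^{n+k}\hat f_n^{-k,l}$ for all $(n,k,l)\in J_N$; (iii) property a)(iii), and $\hat g_{k,j,l}=(-1)^{j}\,\hat g_{-k,j,l}$ for all $k,j,l\in\{-N,\dots,N\}$. c) The following are equivalent: (i) $C_r\subseteq S_L$; (ii) $\hat f_n^{k,l}=0$ for all $(n,k,l)\in J_N$ with $r\nmid l$; (iii) $\hat g_{k,j,l}=0$ for all $k,j,l\in\{-N,\dots,N\}$ with $r\nmid l$. d) The following are equivalent: (i) $D_r\subseteq S_L$; (ii) property c)(ii), and $\hat f_n^{k,l}=(-1)^{n+l}\hat f_n^{k,-l}$ for all $(n,k,l)\in J_N$; (iii) property c)(iii), and $\hat g_{k,j,l}=(-1)^{j}\,\hat g_{k,j,-l}$ for all $k,j,l\in\{-N,\dots,N\}$.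 -/

import Mathlib

open scoped Matrix

noncomputable section

namespace DFS

/-- The rotation group `SO(3)`. -/
abbrev SO3 : Type := Matrix.specialOrthogonalGroup (Fin 3) ℝ

/-- Rotation about the `z`-axis by the angle `t`. -/
def rotZ (t : ℝ) : SO3 :=
  ⟨!![Real.cos t, -Real.sin t, 0; Real.sin t, Real.cos t, 0; 0, 0, 1], by
    rw [Matrix.mem_specialOrthogonalGroup_iff, Matrix.mem_orthogonalGroup_iff]
    have h := Real.sin_sq_add_cos_sq t
    constructor
    · ext i j
      fin_cases i <;> fin_cases j <;>
        simp [Matrix.mul_apply, Fin.sum_univ_three] <;> nlinarith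
    · simp [Matrix.det_fin_three]; nlinarith⟩

/-- Rotation about the `y`-axis by the angle `t`. -/
def rotY (t : ℝ) : SO3 :=
  ⟨!![Real.cos t, 0, Real.sin t; 0, 1, 0; -Real.sin t, 0, Real.cos t], by
    rw [Matrix.mem_specialOrthogonalGroup_iff, Matrix.mem_orthogonalGroup_iff]
    have h := Real.sin_sq_add_cos_sq t
    constructor
    · ext i j
      fin_cases i <;> fin_cases j <;>
        simp [Matrix.mul_apply, Fin.sum_univ_three] <;> nlinarith
    · simp [Matrix.det_fin_three]; nlinarith⟩

/-- The Euler angle parametrization `R(α, β, γ) = R_z(α) R_y(β) R_z(γ)` of `SO(3)`;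
all real angles are allowed, so this is also the parametrization over the torus. -/
def euler (α β γ : ℝ) : SO3 := rotZ α * rotY β * rotZ γ

/-- The Jacobi polynomial `P_s^{(a,b)}` with nonnegative integer parameters, evaluated at `x`. -/
def jacobiP (s a b : ℕ) (x : ℝ) : ℝ :=
  ∑ m ∈ Finset.range (s + 1),
    ((s + a).choose (s - m) : ℝ) * ((s + b).choose m : ℝ) *
      ((x - 1) / 2) ^ m * ((x + 1) / 2) ^ (s - m)

/-- The Wigner-d function `d_n^{k,l}` on `[-1,1]`, for `|k|, |l| ≤ n`. -/
def wignerd (n : ℕ) (k l : ℤ) (x : ℝ) : ℝ :=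
  let a : ℕ := (k - l).natAbs
  let b : ℕ := (k + l).natAbs
  let s : ℕ := n - max k.natAbs l.natAbs
  let ν : ℤ := if l < k then k + l else 0
  (-1 : ℝ) ^ ν * √((2 * n - s).choose (s + a) : ℝ) * (√((s + b).choose b : ℝ))⁻¹ *
    √((1 - x) / 2) ^ a * √((1 + x) / 2) ^ b * jacobiP s a b x

/-- First Euler angle of a rotation. If `sin β = 0` the angles are not unique, and
the choice with third angle `0` is made. -/
def eulerAlpha (R : SO3) : ℝ :=
  if R.1 2 2 ^ 2 = 1 then Complex.arg ⟨R.1 1 1, -R.1 0 1⟩ else Complex.arg ⟨R.1 0 2, R.1 1 2⟩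

/-- Second Euler angle of a rotation, in `[0, π]`. -/
def eulerBeta (R : SO3) : ℝ := Real.arccos (R.1 2 2)

/-- Third Euler angle of a rotation. -/
def eulerGamma (R : SO3) : ℝ :=
  if R.1 2 2 ^ 2 = 1 then 0 else Complex.arg ⟨-R.1 2 0, R.1 2 1⟩

/-- The `L²`-normalized Wigner-D function `D_n^{k,l}` on `SO(3)`; `wignerD_euler` below shows that
its value at `R(α, β, γ)` is `√(2n+1) e^{-ikα} d_n^{k,l}(cos β) e^{-ilγ}` for every choice of Euler
angles with `0 ≤ β ≤ π`. -/
def wignerD (n : ℕ) (k l : ℤ) (R : SO3) : ℂ :=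
  (√(2 * n + 1 : ℝ) : ℂ) * Complex.exp (-Complex.I * k * eulerAlpha R) *
    (wignerd n k l (Real.cos (eulerBeta R)) : ℂ) * Complex.exp (-Complex.I * l * eulerGamma R)

/-- The harmonic series `∑_{n ≤ N} ∑_{|k|,|l| ≤ n} f̂_n^{k,l} D_n^{k,l}`. The `N`-band-limited
functions are exactly the functions of this form. Only the entries of `fhat` with
`n ≤ N` and `|k|, |l| ≤ n` matter. -/
def harmonicSeries (N : ℕ) (fhat : ℕ → ℤ → ℤ → ℂ) (R : SO3) : ℂ :=
  ∑ n ∈ Finset.range (N + 1), ∑ k ∈ Finset.Icc (-(n : ℤ)) n, ∑ l ∈ Finset.Icc (-(n : ℤ)) n,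
    fhat n k l * wignerD n k l R

/-- The Wigner transform `ĝ = W_N f̂`, mapping harmonic coefficients to Fourier coefficients:
`ĝ_{k,j,l} = i^{k-l} ∑_{n = max(|k|,|l|,|j|)}^N √(2n+1) d_n^{j,k}(0) d_n^{j,l}(0) f̂_n^{-k,-l}`. -/
def wignerTransform (N : ℕ) (fhat : ℕ → ℤ → ℤ → ℂ) (k j l : ℤ) : ℂ :=
  Complex.I ^ (k - l) *
    ∑ n ∈ Finset.Icc (max k.natAbs (max l.natAbs j.natAbs)) N,
      (√(2 * n + 1 : ℝ) : ℂ) * (wignerd n j k 0 : ℂ) * (wignerd n j l 0 : ℂ) * fhat n (-k) (-l)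

/-- The cyclic group `C_r` of rotations about the `z`-axis (as a set of rotations). -/
def cyclicSet (r : ℕ) : Set SO3 :=
  {P | ∃ s : ℕ, s < r ∧ P = rotZ (2 * Real.pi * s / r)}

/-- The dihedral group `D_r` (as a set of rotations). -/
def dihedralSet (r : ℕ) : Set SO3 :=
  {P | ∃ c ∈ cyclicSet r, ∃ s : ℕ, s < 2 ∧ P = c * rotY (Real.pi * s)}

/-- `f` has right symmetry `SR` and left symmetry `SL`. -/
def HasSymmetry (f : SO3 → ℂ) (SR SL : Subgroup SO3) : Prop :=
  ∀ sR ∈ SR, ∀ sL ∈ SL, ∀ R : SO3, f R = f (sR * R * sL)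

/-- The right symmetry group of `f`: the rotations `s` with `f (s R) = f R` for all `R`. -/
def rightSymmetryGroup (f : SO3 → ℂ) : Subgroup SO3 where
  carrier := {s | ∀ R : SO3, f (s * R) = f R}
  one_mem' R := by rw [one_mul]
  mul_mem' {a b} ha hb R := by rw [mul_assoc, ha, hb]
  inv_mem' {a} ha R := by rw [← ha (a⁻¹ * R), mul_inv_cancel_left]

/-- The left symmetry group of `f`: the rotations `s` with `f (R s) = f R` for all `R`. -/
def leftSymmetryGroup (f : SO3 → ℂ) : Subgroup SO3 where
  carrier := {s | ∀ R : SO3, f (R * s) = f R}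
  one_mem' R := by rw [mul_one]
  mul_mem' {a b} ha hb R := by rw [← mul_assoc, hb, ha]
  inv_mem' {a} ha R := by rw [← ha (R * a⁻¹), inv_mul_cancel_right]

/-- The two symmetry groups of `f` form the largest pair `(SR, SL)` such that `f` has right
symmetry `SR` and left symmetry `SL`. -/
theorem hasSymmetry_iff (f : SO3 → ℂ) (SR SL : Subgroup SO3) :
    HasSymmetry f SR SL ↔ SR ≤ rightSymmetryGroup f ∧ SL ≤ leftSymmetryGroup f := by
  constructor
  · intro h
    refine ⟨fun s hs R => ?_, fun s hs R => ?_⟩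
    · simpa using (h s hs 1 (one_mem _) R).symm
    · simpa using (h 1 (one_mem _) s hs R).symm
  · rintro ⟨h1, h2⟩ s hs t ht R
    rw [show f (s * R * t) = f (s * R) from h2 ht _, show f (s * R) = f R from h1 hs R]

theorem euler_val (α β γ : ℝ) : (euler α β γ).1 =
    !![Real.cos α * Real.cos β * Real.cos γ - Real.sin α * Real.sin γ,
        -(Real.cos α * Real.cos β * Real.sin γ) - Real.sin α * Real.cos γ,
        Real.cos α * Real.sin β;
      Real.sin α * Real.cos β * Real.cos γ + Real.cos α * Real.sin γ,
        -(Real.sin α * Real.cos β * Real.sin γ) + Real.cos α * Real.cos γ,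
        Real.sin α * Real.sin β;
      -(Real.sin β * Real.cos γ), Real.sin β * Real.sin γ, Real.cos β] := by
  change (!![Real.cos α, -Real.sin α, 0; Real.sin α, Real.cos α, 0; 0, 0, 1] *
    !![Real.cos β, 0, Real.sin β; 0, 1, 0; -Real.sin β, 0, Real.cos β] *
    !![Real.cos γ, -Real.sin γ, 0; Real.sin γ, Real.cos γ, 0; 0, 0, 1] :
      Matrix (Fin 3) (Fin 3) ℝ) = _
  ext i j
  fin_cases i <;> fin_cases j <;> simp [Matrix.mul_apply, Fin.sum_univ_three] <;> ring

theorem exp_arg_aux (m : ℤ) (ρ t : ℝ) (hρ : 0 < ρ) (x y : ℝ) (hx : x = ρ * Real.cos t)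
    (hy : y = ρ * Real.sin t) :
    Complex.exp (-Complex.I * m * (Complex.arg ⟨x, y⟩ : ℝ)) =
      Complex.exp (-Complex.I * m * t) := by
  have hz : (⟨x, y⟩ : ℂ) = ρ * Complex.exp (t * Complex.I) := by
    rw [Complex.exp_mul_I, ← Complex.ofReal_cos, ← Complex.ofReal_sin]
    apply Complex.ext <;>
      simp only [hx, hy, Complex.mul_re, Complex.mul_im, Complex.add_re, Complex.add_im,
        Complex.ofReal_re, Complex.ofReal_im, Complex.I_re, Complex.I_im] <;> ring
  have hn : ‖(⟨x, y⟩ : ℂ)‖ = ρ := by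
    rw [hz, norm_mul, Complex.norm_exp_ofReal_mul_I, mul_one, Complex.norm_real,
      Real.norm_of_nonneg hρ.le]
  have h := Complex.norm_mul_exp_arg_mul_I (⟨x, y⟩ : ℂ)
  rw [hn] at h
  nth_rewrite 2 [hz] at h
  have h2 := mul_left_cancel₀ (Complex.ofReal_ne_zero.mpr hρ.ne') h
  have e (u : ℝ) : Complex.exp (-Complex.I * m * u) = (Complex.exp (u * Complex.I)) ^ (-m) := by
    rw [← Complex.exp_int_mul]; congr 1; push_cast; ring
  rw [e, e, h2]

theorem wignerd_one (n : ℕ) (k l : ℤ) (h : k ≠ l) : wignerd n k l 1 = 0 := by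
  have : (k - l).natAbs ≠ 0 := by omega
  simp [wignerd, this]

theorem wignerd_neg_one (n : ℕ) (k l : ℤ) (h : k ≠ -l) : wignerd n k l (-1) = 0 := by
  have : (k + l).natAbs ≠ 0 := by omega
  simp [wignerd, this]

/-- The defining formula of the Wigner-D functions in Euler angles. -/
theorem wignerD_euler (n : ℕ) (k l : ℤ) (α β γ : ℝ) (h0 : 0 ≤ β) (hπ : β ≤ Real.pi) :
    wignerD n k l (euler α β γ) = (√(2 * n + 1 : ℝ) : ℂ) * Complex.exp (-Complex.I * k * α) *
      (wignerd n k l (Real.cos β) : ℂ) * Complex.exp (-Complex.I * l * γ) := by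
  have hs := Real.sin_sq_add_cos_sq β
  have hb : eulerBeta (euler α β γ) = β := by
    simp [eulerBeta, euler_val, Real.arccos_cos h0 hπ]
  rw [wignerD, hb]
  by_cases hc : Real.cos β ^ 2 = 1
  · have hsin : Real.sin β = 0 := by nlinarith
    have hg : eulerGamma (euler α β γ) = 0 := by simp [eulerGamma, euler_val, hc]
    rcases (by simpa using hc : Real.cos β = 1 ∨ Real.cos β = -1) with hc1 | hc1
    · by_cases hkl : k = l
      · subst hkl
        have ha : Complex.exp (-Complex.I * k * eulerAlpha (euler α β γ)) =
            Complex.exp (-Complex.I * k * ((α + γ : ℝ))) := by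
          rw [eulerAlpha, if_pos (by simp [euler_val, hc])]
          refine exp_arg_aux k 1 _ one_pos _ _ ?_ ?_
          · simp [euler_val, hc1, Real.cos_add]; ring
          · simp [euler_val, hc1, Real.sin_add]; try ring
        rw [ha, hg]
        have : Complex.exp (-Complex.I * k * ((α + γ : ℝ))) =
            Complex.exp (-Complex.I * k * α) * Complex.exp (-Complex.I * k * γ) := by
          rw [← Complex.exp_add]; congr 1; push_cast; ring
        rw [this]; simp only [Complex.ofReal_zero, mul_zero, Complex.exp_zero, mul_one]; ring
      · simp [hc1, wignerd_one n k l hkl]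
    · by_cases hkl : k = -l
      · have ha : Complex.exp (-Complex.I * k * eulerAlpha (euler α β γ)) =
            Complex.exp (-Complex.I * k * ((α - γ : ℝ))) := by
          rw [eulerAlpha, if_pos (by simp [euler_val, hc])]
          refine exp_arg_aux k 1 _ one_pos _ _ ?_ ?_
          · simp [euler_val, hc1, Real.cos_sub]; ring
          · simp [euler_val, hc1, Real.sin_sub]; try ring
        rw [ha, hg]
        have : Complex.exp (-Complex.I * k * ((α - γ : ℝ))) =
            Complex.exp (-Complex.I * k * α) * Complex.exp (-Complex.I * l * γ) := by
          rw [← Complex.exp_add]; congr 1; rw [hkl]; push_cast; ring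
        rw [this]; simp only [Complex.ofReal_zero, mul_zero, Complex.exp_zero, mul_one]; ring
      · simp [hc1, wignerd_neg_one n k l hkl]
  · have hpos : 0 < Real.sin β := by
      refine lt_of_le_of_ne (Real.sin_nonneg_of_nonneg_of_le_pi h0 hπ) fun h => hc ?_
      nlinarith
    have h22 : (euler α β γ).1 2 2 ^ 2 ≠ 1 := by simpa [euler_val] using hc
    rw [eulerAlpha, eulerGamma, if_neg h22, if_neg h22,
      exp_arg_aux k (Real.sin β) α hpos _ _ (by simp [euler_val, mul_comm])
        (by simp [euler_val, mul_comm]),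
      exp_arg_aux l (Real.sin β) γ hpos _ _ (by simp [euler_val]) (by simp [euler_val])]

end DFS

end

noncomputable section

namespace DFS

/-! The Wigner-d functions are matrix coefficients of symmetric powers of `SU(2)`. In the monomial
basis of polynomials of degree at most `2n`, rescaled by `binomNorm`, the symmetric power of
`halfRot β` has entries `wignerdTrig`, and expanding them by the binomial theorem gives the Jacobi
formula (`symPow_eq_jacobiP`, `wignerd_cos`). Over ℂ, `halfRot β` is a diagonal matrix conjugated by
a quarter turn and a phase. Multiplicativity of `symPow` turns this into a finite Fourier expansion
in `β` whose coefficients are products of two values at `cos β = 0` (`wignerdTrig_eq_sum_exp`).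
Summing over `n` gives the Fourier series of `f` in Euler angles (`harmonicSeries_euler`).

In these angles the symmetries are elementary. Multiplication by `rotZ t` translates `α` or `γ`;
multiplication by `rotY π` negates that angle and shifts `β` by `π`. Fourier coefficients are unique
because distinct characters are linearly independent, so (i) and (iii) are equivalent.

For (ii) and (iii), each condition is an equation between a coefficient family and a truncated or
reflected copy of it. The Wigner transform carries these operations to their Fourier counterparts
(`wignerTransform_ite_left`, `wignerTransform_flip_left` and their right versions), and it is
injective (`wignerTransform_eq_iff`), being triangular in `n` when read at `j = n`. -/

/-! ### Symmetric powers of `2 × 2` matrices. -/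

open Polynomial in
/-- The entry `(p, q)` of the `M`-th symmetric power of a `2 × 2` matrix: the coefficient of `X ^ q`
in `(g₀₀ X + g₀₁) ^ p (g₁₀ X + g₁₁) ^ (M - p)`. -/
def symPow {R : Type*} [CommRing R] (M : ℕ) (g : Matrix (Fin 2) (Fin 2) R) (p q : ℕ) : R :=
  ((C (g 0 0) * X + C (g 0 1)) ^ p * (C (g 1 0) * X + C (g 1 1)) ^ (M - p)).coeff q

open Polynomial in
theorem homogenize_linear_pow {R : Type*} [CommRing R] (a b : R) (m : ℕ) :
    ((C a * X + C b) ^ m).homogenize m =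
      (MvPolynomial.C a * MvPolynomial.X 0 + MvPolynomial.C b * MvPolynomial.X 1) ^ m := by
  have h := homogenize_finsetProd (s := Finset.range m) (p := fun _ => C a * X + C b)
    (n := fun _ => 1) (fun _ _ => natDegree_linear_le)
  simpa [homogenize_C_mul] using h

open Polynomial in
theorem aeval_homogenize_eq_sum {R : Type*} [CommRing R] (F : R[X]) (M : ℕ) (U V : R[X]) :
    MvPolynomial.aeval ![U, V] (F.homogenize M) =
      ∑ r ∈ Finset.range (M + 1), C (F.coeff r) * (U ^ r * V ^ (M - r)) := by
  rw [homogenize, map_sum, Finset.Nat.sum_antidiagonal_eq_sum_range_succ_mk]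
  refine Finset.sum_congr rfl fun r _ => ?_
  simp [MvPolynomial.aeval_monomial, Finsupp.prod_fintype, Fin.prod_univ_two]

-- Homogenizing the polynomial that defines `symPow` makes it possible to substitute any `U`, `V`
-- for the two variables. Taking them to be linear forms composes two substitutions, which is how
-- `symPow_mul` arises.
open Polynomial in
theorem linear_pow_mul_linear_pow {R : Type*} [CommRing R] {M : ℕ}
    (g : Matrix (Fin 2) (Fin 2) R) {p : ℕ} (hp : p ≤ M) (U V : R[X]) :
    (C (g 0 0) * U + C (g 0 1) * V) ^ p * (C (g 1 0) * U + C (g 1 1) * V) ^ (M - p) =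
      ∑ r ∈ Finset.range (M + 1), C (symPow M g p r) * (U ^ r * V ^ (M - r)) := by
  have hl (a b : R) (m : ℕ) : ((C a * X + C b) ^ m).natDegree ≤ m :=
    (natDegree_pow_le_of_le m natDegree_linear_le).trans (by simp)
  have h := aeval_homogenize_eq_sum
    ((C (g 0 0) * X + C (g 0 1)) ^ p * (C (g 1 0) * X + C (g 1 1)) ^ (M - p)) M U V
  nth_rewrite 2 [← Nat.add_sub_cancel' hp] at h
  rw [homogenize_mul _ _ (hl _ _ _) (hl _ _ _), homogenize_linear_pow, homogenize_linear_pow] at h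
  simpa [symPow, Polynomial.algebraMap_eq] using h

open Polynomial in
theorem symPow_mul {R : Type*} [CommRing R] {M : ℕ} (g h : Matrix (Fin 2) (Fin 2) R) {p : ℕ}
    (hp : p ≤ M) (q : ℕ) :
    symPow M (g * h) p q = ∑ r ∈ Finset.range (M + 1), symPow M g p r * symPow M h r q := by
  have := congrArg (fun F => F.coeff q) (linear_pow_mul_linear_pow g hp
    (C (h 0 0) * X + C (h 0 1)) (C (h 1 0) * X + C (h 1 1)))
  simp only [finsetSum_coeff, coeff_C_mul] at this
  rw [symPow]
  simp only [symPow] at this ⊢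
  rw [← this]
  congr 2 <;> congr 1 <;> simp only [Matrix.mul_apply, Fin.sum_univ_two, map_add, map_mul] <;> ring

open Polynomial in
theorem coeff_linear_pow {R : Type*} [CommRing R] (a b : R) (m i : ℕ) :
    ((C a * X + C b) ^ m).coeff i = m.choose i * a ^ i * b ^ (m - i) := by
  have h : (C a * X + C b) ^ m = ((X + C b) ^ m).comp (C a * X) := by simp
  rw [h, comp_C_mul_X_coeff, coeff_X_add_C_pow]; ring

open Polynomial in
theorem symPow_eq_sum {R : Type*} [CommRing R] (M : ℕ) (g : Matrix (Fin 2) (Fin 2) R) (p q : ℕ) :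
    symPow M g p q = ∑ i ∈ Finset.range (q + 1),
      (p.choose i * (M - p).choose (q - i) : R) *
        (g 0 0 ^ i * g 0 1 ^ (p - i) * (g 1 0 ^ (q - i) * g 1 1 ^ (M - p - (q - i)))) := by
  rw [symPow, coeff_mul, Finset.Nat.sum_antidiagonal_eq_sum_range_succ_mk]
  refine Finset.sum_congr rfl fun i _ => ?_
  rw [coeff_linear_pow, coeff_linear_pow]; ring

/-- Both sides count the pairs of a `p`-subset and a `q`-subset of an `M`-set that meet in exactly
`i` elements. -/
theorem choose_mul_choose_mul_choose_comm {M p q i : ℕ} (hp : p ≤ M) (hq : q ≤ M) (hiq : i ≤ q)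
    (hip : i ≤ p) :
    M.choose p * (p.choose i * (M - p).choose (q - i)) =
      M.choose q * (q.choose i * (M - q).choose (p - i)) := by
  rw [← mul_assoc, ← mul_assoc, Nat.choose_mul hip, Nat.choose_mul hiq, mul_assoc,
    mul_assoc]
  congr 1
  -- The union of the two subsets has `p + q - i` elements; if that exceeds `M`, there are no such
  -- pairs and both sides vanish.
  by_cases h : p + q ≤ M + i
  · have := Nat.choose_mul (n := M - i) (k := p + q - 2 * i) (s := p - i) (by omega)
    have h2 := Nat.choose_mul (n := M - i) (k := p + q - 2 * i) (s := q - i) (by omega)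
    rw [show M - i - (p - i) = M - p by omega, show p + q - 2 * i - (p - i) = q - i by omega] at this
    rw [show M - i - (q - i) = M - q by omega, show p + q - 2 * i - (q - i) = p - i by omega] at h2
    rw [← this, ← h2]
    congr 1
    exact Nat.choose_symm_of_eq_add (by omega)
  · rw [Nat.choose_eq_zero_of_lt (show M - p < q - i by omega),
      Nat.choose_eq_zero_of_lt (show M - q < p - i by omega)]
    simp

theorem choose_mul_symPow_transpose {R : Type*} [CommRing R] {M : ℕ}
    (g : Matrix (Fin 2) (Fin 2) R) {p q : ℕ} (hp : p ≤ M) (hq : q ≤ M) :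
    (M.choose p : R) * symPow M g p q = M.choose q * symPow M gᵀ q p := by
  have key (g : Matrix (Fin 2) (Fin 2) R) {p q : ℕ} (hp : p ≤ M) (hq : q ≤ M) :
      (M.choose p : R) * symPow M g p q = ∑ i ∈ Finset.range (min p q + 1),
        ((M.choose p * (p.choose i * (M - p).choose (q - i)) : ℕ) : R) *
        (g 0 0 ^ i * g 0 1 ^ (p - i) * (g 1 0 ^ (q - i) * g 1 1 ^ (M + i - (p + q)))) := by
    rw [symPow_eq_sum, Finset.mul_sum]
    symm
    apply Finset.sum_subset_zero_on_sdiff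
    · intro i; simp
    · intro i hi
      simp only [Finset.mem_sdiff, Finset.mem_range] at hi
      rw [Nat.choose_eq_zero_of_lt (show p < i by omega)]; simp
    · intro i hi
      simp only [Finset.mem_range] at hi
      rw [show M - p - (q - i) = M + i - (p + q) by omega]
      push_cast; ring
  rw [key g hp hq, key gᵀ hq hp, min_comm]
  refine Finset.sum_congr rfl fun i hi => ?_
  simp only [Finset.mem_range] at hi
  rw [choose_mul_choose_mul_choose_comm hp hq (by omega) (by omega), add_comm p q]
  simp only [Matrix.transpose_apply]
  ring

open Polynomial in
theorem symPow_diagonal {R : Type*} [CommRing R] {M : ℕ} (a b : R) {p : ℕ} (q : ℕ) :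
    symPow M !![a, 0; 0, b] p q = if q = p then a ^ p * b ^ (M - p) else 0 := by
  simp only [symPow, Matrix.of_apply, Matrix.cons_val', Matrix.cons_val_zero, Matrix.cons_val_one,
    Matrix.cons_val_fin_one, map_zero, zero_mul, zero_add, add_zero, mul_pow, ← C_pow]
  rw [coeff_mul_C, coeff_C_mul, coeff_X_pow]
  split_ifs <;> simp

open Polynomial in
theorem symPow_swap {R : Type*} [CommRing R] {M : ℕ} (p q : ℕ) :
    symPow M (!![0, 1; 1, 0] : Matrix (Fin 2) (Fin 2) R) p q = if q = M - p then 1 else 0 := by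
  simp [symPow, coeff_X_pow]

theorem symPow_mul_diagonal {R : Type*} [CommRing R] {M : ℕ} (g : Matrix (Fin 2) (Fin 2) R)
    (a b : R) {p q : ℕ} (hp : p ≤ M) (hq : q ≤ M) :
    symPow M (g * !![a, 0; 0, b]) p q = symPow M g p q * (a ^ q * b ^ (M - q)) := by
  rw [symPow_mul g _ hp]
  simp only [symPow_diagonal, mul_ite, mul_zero, Finset.sum_ite_eq, Finset.mem_range]
  rw [if_pos (by omega)]

theorem symPow_diagonal_mul {R : Type*} [CommRing R] {M : ℕ} (g : Matrix (Fin 2) (Fin 2) R)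
    (a b : R) {p : ℕ} (q : ℕ) (hp : p ≤ M) :
    symPow M (!![a, 0; 0, b] * g) p q = a ^ p * b ^ (M - p) * symPow M g p q := by
  rw [symPow_mul _ g hp]
  simp only [symPow_diagonal, ite_mul, zero_mul, Finset.sum_ite_eq', Finset.mem_range]
  rw [if_pos (by omega)]

theorem symPow_mul_swap {R : Type*} [CommRing R] {M : ℕ} (g : Matrix (Fin 2) (Fin 2) R)
    {p q : ℕ} (hp : p ≤ M) (hq : q ≤ M) :
    symPow M (g * !![0, 1; 1, 0]) p q = symPow M g p (M - q) := by
  rw [symPow_mul g _ hp, Finset.sum_eq_single_of_mem (M - q) (by simp)]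
  · rw [symPow_swap, if_pos (by omega), mul_one]
  · intro r hr h
    simp only [Finset.mem_range] at hr
    rw [symPow_swap, if_neg (by omega), mul_zero]

theorem symPow_swap_mul {R : Type*} [CommRing R] {M : ℕ} (g : Matrix (Fin 2) (Fin 2) R)
    {p : ℕ} (q : ℕ) (hp : p ≤ M) :
    symPow M (!![0, 1; 1, 0] * g) p q = symPow M g (M - p) q := by
  rw [symPow_mul _ g hp]
  simp only [symPow_swap, ite_mul, zero_mul, one_mul, Finset.sum_ite_eq', Finset.mem_range]
  rw [if_pos (by omega)]

theorem symPow_map {R S : Type*} [CommRing R] [CommRing S] (φ : R →+* S) (M : ℕ)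
    (g : Matrix (Fin 2) (Fin 2) R) (p q : ℕ) :
    symPow M (g.map φ) p q = φ (symPow M g p q) := by
  simp [symPow_eq_sum]

/-! ### Wigner-d functions as matrix coefficients. -/

/-- The element of `SU(2)` over the rotation about the `y`-axis by the angle `β`. -/
def halfRot (β : ℝ) : Matrix (Fin 2) (Fin 2) ℝ :=
  !![Real.cos (β / 2), -Real.sin (β / 2); Real.sin (β / 2), Real.cos (β / 2)]

/-- The norm of `X ^ p` in the space of polynomials of degree at most `M`, up to a factor depending
only on `M`. -/
def binomNorm (M p : ℕ) : ℝ := √(p.factorial * (M - p).factorial : ℝ)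

/-- The function `β ↦ d_n^{k,l}(cos β)`, extended from `[0, π]` to a trigonometric polynomial. -/
def wignerdTrig (n : ℕ) (k l : ℤ) (β : ℝ) : ℝ :=
  binomNorm (2 * n) (n + l).toNat / binomNorm (2 * n) (n + k).toNat *
    symPow (2 * n) (halfRot β) (n + k).toNat (n + l).toNat

theorem binomNorm_pos (M p : ℕ) : 0 < binomNorm M p := by
  unfold binomNorm; positivity

theorem binomNorm_sub {M p : ℕ} (hp : p ≤ M) : binomNorm M (M - p) = binomNorm M p := by
  rw [binomNorm, binomNorm, Nat.sub_sub_self hp, mul_comm]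

theorem binomNorm_sq_mul_choose {M p : ℕ} (hp : p ≤ M) :
    binomNorm M p ^ 2 * M.choose p = M.factorial := by
  rw [binomNorm, Real.sq_sqrt (by positivity), mul_comm, ← mul_assoc]
  exact_mod_cast Nat.choose_mul_factorial_mul_factorial hp

/-- In the rescaled basis the symmetric power commutes with transposition: the square of `binomNorm
M p` is `M!` divided by the binomial coefficient appearing in `choose_mul_symPow_transpose`. -/
theorem binomNorm_div_mul_symPow_transpose {M : ℕ} (g : Matrix (Fin 2) (Fin 2) ℝ) {p q : ℕ}
    (hp : p ≤ M) (hq : q ≤ M) :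
    binomNorm M q / binomNorm M p * symPow M g p q =
      binomNorm M p / binomNorm M q * symPow M gᵀ q p := by
  have h := choose_mul_symPow_transpose g hp hq
  have h1 := binomNorm_sq_mul_choose hp
  have h2 := binomNorm_sq_mul_choose hq
  have p1 := binomNorm_pos M p
  have p2 := binomNorm_pos M q
  have p3 : (M.factorial : ℝ) ≠ 0 := by positivity
  field_simp
  apply mul_left_cancel₀ p3
  calc (M.factorial : ℝ) * (binomNorm M q ^ 2 * symPow M g p q)
      = (binomNorm M p ^ 2 * binomNorm M q ^ 2) * (M.choose p * symPow M g p q) := by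
        rw [← h1]; ring
    _ = (binomNorm M p ^ 2 * binomNorm M q ^ 2) * (M.choose q * symPow M gᵀ q p) := by rw [h]
    _ = _ := by rw [← h2]; ring

/-- The transpose is conjugate to the matrix itself in two ways. The swap reverses the indices of
the symmetric power, while `diag(1, -1)` (in `halfRot_transpose'`) produces signs; the index
symmetries of `wignerdTrig` come from combining them. -/
theorem halfRot_transpose (β : ℝ) :
    (halfRot β)ᵀ = !![0, 1; 1, 0] * (halfRot β * !![0, 1; 1, 0]) := by
  ext i j; fin_cases i <;> fin_cases j <;> simp [halfRot]

theorem halfRot_transpose' (β : ℝ) :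
    (halfRot β)ᵀ = !![1, 0; 0, -1] * (halfRot β * !![1, 0; 0, -1]) := by
  ext i j; fin_cases i <;> fin_cases j <;> simp [halfRot]

theorem halfRot_neg (β : ℝ) : halfRot (-β) = (halfRot β)ᵀ := by
  ext i j; fin_cases i <;> fin_cases j <;> simp [halfRot, neg_div]

theorem halfRot_add_two_pi (β : ℝ) :
    halfRot (β + 2 * Real.pi) = halfRot β * !![-1, 0; 0, -1] := by
  have h : (β + 2 * Real.pi) / 2 = β / 2 + Real.pi := by ring
  ext i j; fin_cases i <;> fin_cases j <;>
    simp [halfRot, h, Real.cos_add_pi, Real.sin_add_pi]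

theorem wignerdTrig_neg_swap {n : ℕ} {k l : ℤ} (hk : |k| ≤ n) (hl : |l| ≤ n) (β : ℝ) :
    wignerdTrig n (-l) (-k) β = wignerdTrig n k l β := by
  rw [abs_le] at hk hl
  obtain ⟨p, hp⟩ : ∃ p, (n + k).toNat = p := ⟨_, rfl⟩
  obtain ⟨q, hq⟩ : ∃ q, (n + l).toNat = q := ⟨_, rfl⟩
  rw [wignerdTrig, wignerdTrig, show (n + -l).toNat = 2 * n - q by omega,
    show (n + -k).toNat = 2 * n - p by omega, hp, hq,
    binomNorm_div_mul_symPow_transpose _ (show p ≤ 2 * n by omega) (show q ≤ 2 * n by omega),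
    halfRot_transpose, symPow_swap_mul _ _ (by omega), symPow_mul_swap _ (by omega) (by omega),
    binomNorm_sub (by omega), binomNorm_sub (by omega)]

theorem neg_one_pow_toNat_mul {n : ℕ} {k l : ℤ} (hk : |k| ≤ n) (hl : |l| ≤ n) :
    (-1 : ℝ) ^ (2 * n - (n + k).toNat) * (-1) ^ (2 * n - (n + l).toNat) = (-1) ^ (k + l) := by
  rw [abs_le] at hk hl
  rw [← pow_add, ← zpow_natCast]
  have : ((2 * n - (n + k).toNat + (2 * n - (n + l).toNat) : ℕ) : ℤ)
    = (k + l) + 2 * (n - k - l) := by omega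
  rw [this, zpow_add₀ (by norm_num), zpow_mul]; simp

theorem wignerdTrig_angle_neg {n : ℕ} {k l : ℤ} (hk : |k| ≤ n) (hl : |l| ≤ n) (β : ℝ) :
    wignerdTrig n k l (-β) = (-1) ^ (k + l) * wignerdTrig n k l β := by
  have h := neg_one_pow_toNat_mul hk hl
  rw [abs_le] at hk hl
  rw [wignerdTrig, halfRot_neg, halfRot_transpose', symPow_diagonal_mul _ _ _ _ (by omega),
    symPow_mul_diagonal _ _ _ (by omega) (by omega), wignerdTrig, ← h]
  simp only [one_pow, one_mul]
  ring

theorem wignerdTrig_neg_neg {n : ℕ} {k l : ℤ} (hk : |k| ≤ n) (hl : |l| ≤ n) (β : ℝ) :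
    wignerdTrig n (-k) (-l) β = (-1) ^ (k + l) * wignerdTrig n k l β := by
  rw [← wignerdTrig_angle_neg hk hl]
  rw [abs_le] at hk hl
  obtain ⟨p, hp⟩ : ∃ p, (n + k).toNat = p := ⟨_, rfl⟩
  obtain ⟨q, hq⟩ : ∃ q, (n + l).toNat = q := ⟨_, rfl⟩
  rw [wignerdTrig, wignerdTrig, show (n + -l).toNat = 2 * n - q by omega,
    show (n + -k).toNat = 2 * n - p by omega, hp, hq, halfRot_neg,
    halfRot_transpose, symPow_swap_mul _ _ (by omega), symPow_mul_swap _ (by omega) (by omega),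
    binomNorm_sub (by omega), binomNorm_sub (by omega)]

/-- A full turn changes the sign of `halfRot`, which is invisible in a symmetric power of even
degree `2n`. -/
theorem wignerdTrig_add_two_pi {n : ℕ} {k l : ℤ} (hk : |k| ≤ n) (hl : |l| ≤ n) (β : ℝ) :
    wignerdTrig n k l (β + 2 * Real.pi) = wignerdTrig n k l β := by
  rw [abs_le] at hk hl
  rw [wignerdTrig, halfRot_add_two_pi, symPow_mul_diagonal _ _ _ (by omega) (by omega),
    ← pow_add, Nat.add_sub_cancel' (by omega), pow_mul]
  simp [wignerdTrig]

theorem symPow_eq_jacobiP (s a b : ℕ) {c σ : ℝ} (h : c ^ 2 + σ ^ 2 = 1) :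
    symPow (2 * s + a + b) !![c, -σ; σ, c] (s + b) (s + a + b) =
      σ ^ a * c ^ b * jacobiP s a b (c ^ 2 - σ ^ 2) := by
  rw [symPow_eq_sum, jacobiP, Finset.mul_sum]
  symm
  -- The Jacobi summand `m` is the binomial summand `i = s + b - m`; those with `i < b` or `i > s +
  -- b` contain a vanishing binomial coefficient.
  apply Finset.sum_of_injOn (fun m => s + b - m)
  · intro x hx y hy hxy
    simp only [Finset.coe_range, Set.mem_Iio] at *
    omega
  · intro x hx
    simp only [Finset.coe_range, Set.mem_Iio] at *
    omega
  · intro i hi hni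
    by_cases h1 : i < b
    · rw [Nat.choose_eq_zero_of_lt (show 2 * s + a + b - (s + b) < s + a + b - i by omega)]
      simp
    · have : s + b < i := by
        by_contra hh
        exact hni ⟨s + b - i, by simp only [Finset.coe_range, Set.mem_Iio]; omega,
          by simp only; omega⟩
      rw [Nat.choose_eq_zero_of_lt this]; simp
  · intro m hm
    simp only [Finset.mem_range] at hm
    have e1 : s + a + b - (s + b - m) = a + m := by omega
    have e2 : 2 * s + a + b - (s + b) = s + a := by omega
    have e3 : s + b - (s + b - m) = m := by omega
    have e4 : s + a - (a + m) = s - m := by omega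
    have e5 : s + b - m = b + (s - m) := by omega
    have e6 : (s + a).choose (a + m) = (s + a).choose (s - m) :=
      Nat.choose_symm_of_eq_add (by omega)
    have e7 : (s + b).choose (s + b - m) = (s + b).choose m := Nat.choose_symm (by omega)
    have e8 : (c ^ 2 - σ ^ 2 - 1) / 2 = -σ * σ := by rw [← h]; ring
    have e9 : (c ^ 2 - σ ^ 2 + 1) / 2 = c * c := by rw [← h]; ring
    simp only [Matrix.of_apply, Matrix.cons_val', Matrix.cons_val_zero, Matrix.cons_val_one,
      Matrix.cons_val_fin_one]
    rw [e1, e2, e3, e4, e6, e7, e5, e8, e9, mul_pow, mul_pow, pow_add, pow_add]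
    ring

theorem binomNorm_div_binomNorm (s a b : ℕ) :
    binomNorm (2 * s + a + b) (s + a + b) / binomNorm (2 * s + a + b) (s + b) =
      √((s + a + b).choose (s + a) : ℝ) * (√((s + b).choose b : ℝ))⁻¹ := by
  rw [binomNorm, binomNorm, ← Real.sqrt_div (by positivity), ← Real.sqrt_inv,
    ← Real.sqrt_mul (by positivity), show 2 * s + a + b - (s + a + b) = s by omega,
    show 2 * s + a + b - (s + b) = s + a by omega, Nat.cast_choose ℝ (by omega),
    Nat.cast_choose ℝ (by omega), show s + a + b - (s + a) = b by omega,
    show s + b - b = s by omega]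
  congr 1
  field_simp

/-- In this sector the absolute values resolve to `a = l - k`, `b = k + l`, `s = n - l` and the sign
is trivial, so the two formulas match directly. The restriction on `β` makes the half-angle sine and
cosine nonnegative, hence equal to the square roots. -/
theorem wignerd_cos_of_le {n : ℕ} {k l : ℤ} (hkl : |k| ≤ l) (hl : l ≤ n) {β : ℝ} (h0 : 0 ≤ β)
    (hπ : β ≤ Real.pi) : wignerd n k l (Real.cos β) = wignerdTrig n k l β := by
  rw [abs_le] at hkl
  obtain ⟨a, ha⟩ : ∃ a, (k - l).natAbs = a := ⟨_, rfl⟩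
  obtain ⟨b, hb⟩ : ∃ b, (k + l).natAbs = b := ⟨_, rfl⟩
  obtain ⟨s, hs⟩ : ∃ s, n - max k.natAbs l.natAbs = s := ⟨_, rfl⟩
  have hx : Real.cos β = Real.cos (β / 2) ^ 2 - Real.sin (β / 2) ^ 2 := by
    rw [← Real.cos_two_mul']; congr 1; ring
  have h1 := Real.cos_sq_add_sin_sq (β / 2)
  have hc : √((1 + Real.cos β) / 2) = Real.cos (β / 2) := by
    rw [Real.cos_half (by linarith) hπ]
  have hσ : √((1 - Real.cos β) / 2) = Real.sin (β / 2) :=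
    (Real.sin_half_eq_sqrt h0 (by linarith)).symm
  rw [wignerd, wignerdTrig]
  simp only [ha, hb, hs]
  rw [if_neg (by omega), hc, hσ, show 2 * n = 2 * s + a + b by omega,
    show (n + l).toNat = s + a + b by omega, show (n + k).toNat = s + b by omega,
    binomNorm_div_binomNorm, halfRot, symPow_eq_jacobiP _ _ _ h1, hx,
    show 2 * s + a + b - s = s + a + b by omega]
  simp only [zpow_zero, one_mul]
  ring

theorem neg_one_zpow_mul_self (m : ℤ) : (-1 : ℝ) ^ m * (-1) ^ m = 1 := by
  rw [← mul_zpow]; simp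

theorem wignerd_swap (n : ℕ) (k l : ℤ) (x : ℝ) :
    wignerd n l k x = (-1) ^ (k + l) * wignerd n k l x := by
  have e1 : (l - k).natAbs = (k - l).natAbs := by omega
  have h := neg_one_zpow_mul_self (k + l)
  simp only [wignerd, e1, add_comm l k, max_comm l.natAbs k.natAbs]
  rcases lt_trichotomy k l with hlt | rfl | hlt
  · rw [if_pos hlt, if_neg hlt.not_gt]; simp only [zpow_zero]; ring
  · rw [if_neg (lt_irrefl k), ← two_mul, zpow_mul]; simp
  · rw [if_neg hlt.not_gt, if_pos hlt]; simp only [← mul_assoc, h, zpow_zero]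

theorem wignerd_neg_neg (n : ℕ) (k l : ℤ) (x : ℝ) :
    wignerd n (-k) (-l) x = (-1) ^ (k + l) * wignerd n k l x := by
  have e1 : (-k - -l).natAbs = (k - l).natAbs := by omega
  have e2 : (-k + -l).natAbs = (k + l).natAbs := by omega
  have h := neg_one_zpow_mul_self (k + l)
  simp only [wignerd, e1, e2, Int.natAbs_neg, neg_lt_neg_iff]
  rcases lt_trichotomy k l with hlt | rfl | hlt
  · rw [if_pos hlt, if_neg hlt.not_gt, show -k + -l = -(k + l) by ring, zpow_neg, ← inv_zpow,
      show ((-1 : ℝ))⁻¹ = -1 by norm_num, zpow_zero]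
    ring
  · rw [if_neg (lt_irrefl k), ← two_mul, zpow_mul]; simp
  · rw [if_neg hlt.not_gt, if_pos hlt]; simp only [← mul_assoc, h, zpow_zero]

/-- On `[0, π]`, the trigonometric polynomial `wignerdTrig` is the Wigner-d function at `cos β`. -/
theorem wignerd_cos {n : ℕ} {k l : ℤ} (hk : |k| ≤ n) (hl : |l| ≤ n) {β : ℝ} (h0 : 0 ≤ β)
    (hπ : β ≤ Real.pi) : wignerd n k l (Real.cos β) = wignerdTrig n k l β := by
  -- Both functions obey the same rules under negating both indices and under exchanging them, which
  -- moves any `(k, l)` into the sector `|k| ≤ l`.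
  have aux {k l : ℤ} (hkl : |k| ≤ |l|) (hk : |k| ≤ n) (hl : |l| ≤ n) :
      wignerd n k l (Real.cos β) = wignerdTrig n k l β := by
    rcases le_total 0 l with h | h
    · rw [abs_of_nonneg h] at hkl hl
      exact wignerd_cos_of_le hkl hl h0 hπ
    · have := @wignerd_cos_of_le n (-k) (-l) (by rwa [abs_neg, ← abs_of_nonpos h])
        (by rwa [← abs_of_nonpos h]) β h0 hπ
      rw [wignerd_neg_neg, wignerdTrig_neg_neg hk hl] at this
      exact mul_left_cancel₀ (zpow_ne_zero _ (by norm_num)) this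
  rcases le_total |k| |l| with h | h
  · exact aux h hk hl
  · rw [wignerd_swap n l k, aux h hl hk, ← wignerdTrig_neg_swap hl hk,
      wignerdTrig_neg_neg hk hl, ← mul_assoc, add_comm l k, neg_one_zpow_mul_self, one_mul]

/-! ### Fourier expansion in `β` and values at `cos β = 0`. -/

theorem sum_range_eq_sum_Icc {A : Type*} [AddCommMonoid A] (n : ℕ) (F : ℕ → A) :
    ∑ r ∈ Finset.range (2 * n + 1), F r = ∑ j ∈ Finset.Icc (-(n : ℤ)) n, F (n + j).toNat := by
  refine Finset.sum_nbij' (fun r : ℕ => (r : ℤ) - n) (fun j : ℤ => (n + j).toNat) ?_ ?_ ?_ ?_ ?_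
  · intro r hr; simp only [Finset.mem_range, Finset.mem_Icc] at *; omega
  · intro r hr; simp only [Finset.mem_range, Finset.mem_Icc] at *; omega
  · intro r hr; simp only [Finset.mem_range] at *; omega
  · intro r hr; simp only [Finset.mem_Icc] at *; omega
  · intro r hr; congr 1; omega

theorem sum_Icc_neg {A : Type*} [AddCommMonoid A] (n : ℕ) (F : ℤ → A) :
    ∑ k ∈ Finset.Icc (-(n : ℤ)) n, F k = ∑ k ∈ Finset.Icc (-(n : ℤ)) n, F (-k) := by
  refine Finset.sum_equiv (Equiv.neg ℤ) ?_ ?_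
  · intro i; simp only [Finset.mem_Icc, Equiv.neg_apply]; omega
  · intro i _; simp

/-- Diagonalization of a rotation about the `y`-axis: it is conjugate to one about the `z`-axis. -/
theorem halfRot_eq_conj_diagonal (β : ℝ) :
    (halfRot β).map Complex.ofRealHom = !![1, 0; 0, -Complex.I] *
      ((halfRot (Real.pi / 2)).map Complex.ofRealHom *
        !![Complex.exp (Complex.I * β / 2), 0; 0, Complex.exp (-(Complex.I * β / 2))] *
        ((halfRot (Real.pi / 2))ᵀ.map Complex.ofRealHom * !![1, 0; 0, Complex.I])) := by
  have h4 : Real.pi / 2 / 2 = Real.pi / 4 := by ring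
  have h2 : ((√2 : ℝ) : ℂ) * ((√2 : ℝ) : ℂ) = 2 := by
    rw [← Complex.ofReal_mul]; norm_num
  have e1 : Complex.I * β / 2 = (β / 2 : ℂ) * Complex.I := by ring
  have e2 := Complex.I_mul_I
  rw [e1, Complex.exp_mul_I, ← neg_mul, Complex.exp_mul_I, Complex.cos_neg, Complex.sin_neg]
  ext i j
  fin_cases i <;> fin_cases j <;>
    simp [halfRot, Matrix.mul_apply, Fin.sum_univ_two, h4, Real.cos_pi_div_four,
      Real.sin_pi_div_four]
  · linear_combination (-(1 / 2) * Complex.cos (β / 2)) * h2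
  · linear_combination (1 / 2 * Complex.sin (β / 2)) * h2 -
      (1 / 2 * ((√2 : ℝ) : ℂ) * ((√2 : ℝ) : ℂ) * Complex.sin (β / 2)) * e2
  · linear_combination (-(1 / 2) * Complex.sin (β / 2)) * h2 +
      (1 / 2 * ((√2 : ℝ) : ℂ) * ((√2 : ℝ) : ℂ) * Complex.sin (β / 2)) * e2
  · linear_combination (-(1 / 2) * Complex.cos (β / 2)) * h2 +
      (1 / 2 * ((√2 : ℝ) : ℂ) * ((√2 : ℝ) : ℂ) * Complex.cos (β / 2)) * e2

theorem neg_I_pow_mul_I_pow {n p q : ℕ} {k l : ℤ} (hp : (p : ℤ) = n + k) (hq : (q : ℤ) = n + l)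
    (hpn : p ≤ 2 * n) (hqn : q ≤ 2 * n) :
    (-Complex.I) ^ (2 * n - p) * Complex.I ^ (2 * n - q) = Complex.I ^ (k - l) := by
  have hI : Complex.I ≠ 0 := Complex.I_ne_zero
  rw [← Complex.inv_I, ← zpow_natCast, ← zpow_natCast, inv_zpow, ← zpow_neg, ← zpow_add₀ hI]
  congr 1
  omega

theorem exp_pow_mul_exp_neg_pow {n r : ℕ} {j : ℤ} (hr : (r : ℤ) = n + j) (hrn : r ≤ 2 * n)
    (z : ℂ) : Complex.exp (z / 2) ^ r * Complex.exp (-(z / 2)) ^ (2 * n - r) =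
      Complex.exp (j * z) := by
  rw [← Complex.exp_nat_mul, ← Complex.exp_nat_mul, ← Complex.exp_add]
  congr 1
  have : (j : ℂ) = r - n := by
    rw [show j = (r : ℤ) - n by omega]; push_cast; ring
  rw [this, Nat.cast_sub hrn]
  push_cast
  ring

/-- This is the symmetric power of `halfRot_eq_conj_diagonal`: the outer diagonal factors give `I ^
(k - l)`, the middle one the exponentials, and the quarter turns the two coefficients. -/
theorem wignerdTrig_eq_sum_exp {n : ℕ} {k l : ℤ} (hk : |k| ≤ n) (hl : |l| ≤ n) (β : ℝ) :
    (wignerdTrig n k l β : ℂ) = Complex.I ^ (k - l) * ∑ j ∈ Finset.Icc (-(n : ℤ)) n,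
      (wignerdTrig n k j (Real.pi / 2) : ℂ) * (wignerdTrig n l j (Real.pi / 2) : ℂ) *
        Complex.exp (j * (Complex.I * β)) := by
  rw [abs_le] at hk hl
  obtain ⟨p, hp⟩ : ∃ p, (n + k).toNat = p := ⟨_, rfl⟩
  obtain ⟨q, hq⟩ : ∃ q, (n + l).toNat = q := ⟨_, rfl⟩
  have hpn : p ≤ 2 * n := by omega
  have hqn : q ≤ 2 * n := by omega
  have hS : ((symPow (2 * n) (halfRot β) p q : ℝ) : ℂ) = Complex.I ^ (k - l) *
      ∑ r ∈ Finset.range (2 * n + 1), ((symPow (2 * n) (halfRot (Real.pi / 2)) p r : ℝ) : ℂ) *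
        ((symPow (2 * n) (halfRot (Real.pi / 2))ᵀ r q : ℝ) : ℂ) *
        (Complex.exp (Complex.I * β / 2) ^ r *
          Complex.exp (-(Complex.I * β / 2)) ^ (2 * n - r)) := by
    change Complex.ofRealHom _ = _
    rw [← symPow_map, halfRot_eq_conj_diagonal, symPow_diagonal_mul _ _ _ _ hpn,
      symPow_mul _ _ hpn, ← neg_I_pow_mul_I_pow (n := n) (p := p) (q := q) (by omega) (by omega)
        hpn hqn, one_pow, one_mul, mul_assoc, Finset.mul_sum _ _ (Complex.I ^ (2 * n - q))]
    congr 1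
    refine Finset.sum_congr rfl fun r hr => ?_
    simp only [Finset.mem_range] at hr
    rw [symPow_mul_diagonal _ _ _ hpn (by omega), symPow_mul_diagonal _ _ _ (by omega) hqn,
      symPow_map, symPow_map]
    simp only [one_pow, Complex.ofRealHom_eq_coe]
    ring
  -- Transposing the second quarter turn distributes the normalization so that both factors become
  -- values of `wignerdTrig`.
  have key (r : ℕ) (hr : r ≤ 2 * n) :
      binomNorm (2 * n) q / binomNorm (2 * n) p *
        (symPow (2 * n) (halfRot (Real.pi / 2)) p r *
          symPow (2 * n) (halfRot (Real.pi / 2))ᵀ r q) =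
      (binomNorm (2 * n) r / binomNorm (2 * n) p * symPow (2 * n) (halfRot (Real.pi / 2)) p r) *
      (binomNorm (2 * n) r / binomNorm (2 * n) q *
        symPow (2 * n) (halfRot (Real.pi / 2)) q r) := by
    rw [binomNorm_div_mul_symPow_transpose _ hqn hr]
    have h1 := binomNorm_pos (2 * n) p
    have h2 := binomNorm_pos (2 * n) r
    field_simp
  rw [wignerdTrig, hp, hq, Complex.ofReal_mul, hS, mul_left_comm, Finset.mul_sum,
    sum_range_eq_sum_Icc]
  congr 1
  refine Finset.sum_congr rfl fun j hj => ?_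
  simp only [Finset.mem_Icc] at hj
  rw [exp_pow_mul_exp_neg_pow (j := j) (by omega) (by omega), wignerdTrig, wignerdTrig, hp, hq]
  have hkey := congrArg Complex.ofReal (key (n + j).toNat (by omega))
  push_cast at hkey ⊢
  linear_combination Complex.exp (j * (Complex.I * β)) * hkey

theorem wignerd_zero {n : ℕ} {k l : ℤ} (hk : |k| ≤ n) (hl : |l| ≤ n) :
    wignerd n k l 0 = wignerdTrig n k l (Real.pi / 2) := by
  rw [← wignerd_cos hk hl (by positivity) (by linarith [Real.pi_pos]), Real.cos_pi_div_two]

/-- Negating both indices costs `(-1) ^ (k + l)`, which is also the combined sign of exchanging the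
indices in the two values at `0`. This is the form that matches `wignerTransform`. -/
theorem wignerdTrig_neg_neg_eq_sum_exp {n : ℕ} {k l : ℤ} (hk : |k| ≤ n) (hl : |l| ≤ n) (β : ℝ) :
    (wignerdTrig n (-k) (-l) β : ℂ) = Complex.I ^ (k - l) * ∑ j ∈ Finset.Icc (-(n : ℤ)) n,
      (wignerd n j k 0 : ℂ) * (wignerd n j l 0 : ℂ) * Complex.exp (j * (Complex.I * β)) := by
  rw [wignerdTrig_neg_neg hk hl, Complex.ofReal_mul, wignerdTrig_eq_sum_exp hk hl, mul_left_comm,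
    Finset.mul_sum]
  congr 1
  refine Finset.sum_congr rfl fun j hj => ?_
  have hj' : |j| ≤ n := by rwa [Finset.mem_Icc, ← abs_le] at hj
  rw [wignerd_swap n k j, wignerd_swap n l j, wignerd_zero hk hj', wignerd_zero hl hj']
  have : ((-1 : ℝ)) ^ (k + l) = (-1) ^ (k + j) * (-1) ^ (l + j) := by
    rw [← zpow_add₀ (by norm_num), show k + j + (l + j) = k + l + 2 * j by ring,
      zpow_add₀ (by norm_num) (k + l), zpow_mul]
    simp
  rw [this]
  push_cast
  ring

/-- The quarter turn intertwines the swap with `diag(-1, 1)`, so reversing the column index costs a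
sign depending only on the row. -/
theorem symPow_halfRot_pi_div_two_sub {M p q : ℕ} (hp : p ≤ M) (hq : q ≤ M) :
    symPow M (halfRot (Real.pi / 2)) p (M - q) =
      (-1) ^ p * symPow M (halfRot (Real.pi / 2)) p q := by
  have h4 : Real.pi / 2 / 2 = Real.pi / 4 := by ring
  have h : halfRot (Real.pi / 2) * !![0, 1; 1, 0] = !![-1, 0; 0, 1] * halfRot (Real.pi / 2) := by
    ext i j
    fin_cases i <;> fin_cases j <;>
      simp [halfRot, h4, Real.cos_pi_div_four, Real.sin_pi_div_four]
  rw [← symPow_mul_swap _ hp hq, h, symPow_diagonal_mul _ _ _ _ hp, one_pow, mul_one]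

theorem wignerd_zero_neg_right {n : ℕ} {j k : ℤ} (hj : |j| ≤ n) (hk : |k| ≤ n) :
    wignerd n j (-k) 0 = (-1) ^ ((n : ℤ) + j) * wignerd n j k 0 := by
  rw [wignerd_zero hj hk, wignerd_zero hj (by rwa [abs_neg])]
  rw [abs_le] at hj hk
  rw [wignerdTrig, show (n + -k).toNat = 2 * n - (n + k).toNat by omega,
    symPow_halfRot_pi_div_two_sub (by omega) (by omega), binomNorm_sub (by omega), wignerdTrig,
    ← zpow_natCast, show (((n + j).toNat : ℕ) : ℤ) = n + j by omega]
  ring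

/-- With first index `n` the Jacobi degree is `0`, so only nonzero elementary factors remain. These
are the diagonal entries that make the Wigner transform invertible. -/
theorem wignerd_zero_top_ne_zero {n : ℕ} {k : ℤ} (hk : |k| ≤ n) : wignerd n n k 0 ≠ 0 := by
  rw [abs_le] at hk
  have hs : n - max (n : ℤ).natAbs k.natAbs = 0 := by omega
  have h1 : 0 < (2 * n).choose ((n : ℤ) - k).natAbs := Nat.choose_pos (by omega)
  simp only [wignerd, hs]
  have : (-1 : ℝ) ^ (if k < n then (n : ℤ) + k else 0) ≠ 0 := zpow_ne_zero _ (by norm_num)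
  have h2 : √((2 * n).choose ((n : ℤ) - k).natAbs : ℝ) ≠ 0 := by positivity
  have hj (a b : ℕ) : jacobiP 0 a b 0 = 1 := by simp [jacobiP]
  rw [hj, mul_one, Nat.sub_zero, zero_add, zero_add, Nat.choose_self]
  refine mul_ne_zero (mul_ne_zero (mul_ne_zero (mul_ne_zero this h2) ?_) ?_) ?_ <;> positivity

/-! ### The Fourier series in Euler angles. -/

theorem euler_add_two_pi (α β γ : ℝ) : euler α (β + 2 * Real.pi) γ = euler α β γ := by
  apply Subtype.ext
  rw [euler_val, euler_val, Real.cos_add_two_pi, Real.sin_add_two_pi]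

theorem euler_neg (α β γ : ℝ) : euler α (-β) γ = euler (α + Real.pi) β (γ - Real.pi) := by
  apply Subtype.ext
  rw [euler_val, euler_val, Real.cos_neg, Real.sin_neg, Real.cos_add_pi, Real.sin_add_pi,
    Real.cos_sub_pi, Real.sin_sub_pi]
  ext i j
  fin_cases i <;> fin_cases j <;> simp

/-- The defining formula of the Wigner-D functions, for all real angles. -/
theorem wignerD_euler_real {n : ℕ} {k l : ℤ} (hk : |k| ≤ n) (hl : |l| ≤ n) (α β γ : ℝ) :
    wignerD n k l (euler α β γ) = (√(2 * n + 1 : ℝ) : ℂ) * Complex.exp (-Complex.I * k * α) *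
      (wignerdTrig n k l β : ℂ) * Complex.exp (-Complex.I * l * γ) := by
  -- Both sides are `2π`-periodic in `β`, so `β` may be taken in `[-π, π]`. A negative angle is then
  -- reflected by `euler_neg`, whose shifts of `α` and `γ` by `π` give the sign of
  -- `wignerdTrig_angle_neg`.
  obtain ⟨m, β₀, hβ₀, h1, h2⟩ : ∃ (m : ℤ) (β₀ : ℝ), β₀ = β - m * (2 * Real.pi) ∧
      -Real.pi ≤ β₀ ∧ β₀ ≤ Real.pi := by
    have h := Int.sub_floor_div_mul_nonneg (β + Real.pi) Real.two_pi_pos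
    have h' := Int.sub_floor_div_mul_lt (β + Real.pi) Real.two_pi_pos
    exact ⟨⌊(β + Real.pi) / (2 * Real.pi)⌋, _, rfl, by linarith, by linarith⟩
  have e1 : euler α β γ = euler α β₀ γ := by
    have : Function.Periodic (fun b => euler α b γ) (2 * Real.pi) :=
      fun b => euler_add_two_pi α b γ
    rw [hβ₀]; exact (this.sub_int_mul_eq m).symm
  have e2 : wignerdTrig n k l β = wignerdTrig n k l β₀ := by
    have : Function.Periodic (wignerdTrig n k l) (2 * Real.pi) := wignerdTrig_add_two_pi hk hl
    rw [hβ₀]; exact (this.sub_int_mul_eq m).symm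
  rw [e1, e2]
  rcases le_total 0 β₀ with h0 | h0
  · rw [wignerD_euler _ _ _ _ _ _ h0 h2, wignerd_cos hk hl h0 h2]
  · obtain ⟨b, rfl⟩ : ∃ b, β₀ = -b := ⟨-β₀, by ring⟩
    rw [euler_neg, wignerD_euler _ _ _ _ _ _ (by linarith) (by linarith),
      wignerd_cos hk hl (by linarith) (by linarith), wignerdTrig_angle_neg hk hl]
    have e (m : ℤ) : Complex.exp (-Complex.I * m * Real.pi) = (-1) ^ m := by
      rw [show -Complex.I * m * Real.pi = (-m : ℤ) * (Real.pi * Complex.I) by push_cast; ring,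
        Complex.exp_int_mul, Complex.exp_pi_mul_I, zpow_neg, ← inv_zpow]
      norm_num
    have e' : Complex.exp (-Complex.I * l * ((γ - Real.pi : ℝ) : ℂ)) =
        Complex.exp (-Complex.I * l * γ) * (-1) ^ l := by
      rw [show -Complex.I * l * ((γ - Real.pi : ℝ) : ℂ) = -Complex.I * l * γ +
        -Complex.I * (-l : ℤ) * Real.pi by push_cast; ring, Complex.exp_add, e, zpow_neg,
        ← inv_zpow]
      norm_num
    rw [show -Complex.I * k * ((α + Real.pi : ℝ) : ℂ) = -Complex.I * k * α +
      -Complex.I * k * Real.pi by push_cast; ring, Complex.exp_add, e, e',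
      zpow_add₀ (by norm_num)]
    push_cast
    ring

theorem wignerTransform_eq_sum_ite (N : ℕ) (fhat : ℕ → ℤ → ℤ → ℂ) (k j l : ℤ) :
    wignerTransform N fhat k j l = ∑ n ∈ Finset.range (N + 1),
      if k.natAbs ≤ n ∧ j.natAbs ≤ n ∧ l.natAbs ≤ n then Complex.I ^ (k - l) *
        ((√(2 * n + 1 : ℝ) : ℂ) * (wignerd n j k 0 : ℂ) * (wignerd n j l 0 : ℂ) *
          fhat n (-k) (-l)) else 0 := by
  rw [wignerTransform, Finset.mul_sum, ← Finset.sum_filter]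
  refine Finset.sum_congr ?_ fun _ _ => rfl
  ext n
  simp only [Finset.mem_Icc, Finset.mem_filter, Finset.mem_range]
  omega

/-- The Fourier series of the double Fourier sphere transform of a harmonic series. -/
theorem harmonicSeries_euler (N : ℕ) (fhat : ℕ → ℤ → ℤ → ℂ) (α β γ : ℝ) :
    harmonicSeries N fhat (euler α β γ) =
      ∑ k ∈ Finset.Icc (-(N : ℤ)) N, ∑ j ∈ Finset.Icc (-(N : ℤ)) N,
        ∑ l ∈ Finset.Icc (-(N : ℤ)) N, wignerTransform N fhat k j l *
          Complex.exp (Complex.I * (k * α + j * β + l * γ)) := by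
  simp only [wignerTransform_eq_sum_ite, Finset.sum_mul, ite_mul, zero_mul]
  have swap (F : ℤ → ℤ → ℤ → ℕ → ℂ) :
      ∑ k ∈ Finset.Icc (-(N : ℤ)) N, ∑ j ∈ Finset.Icc (-(N : ℤ)) N,
        ∑ l ∈ Finset.Icc (-(N : ℤ)) N, ∑ n ∈ Finset.range (N + 1),
          (if k.natAbs ≤ n ∧ j.natAbs ≤ n ∧ l.natAbs ≤ n then F k j l n else 0) =
      ∑ n ∈ Finset.range (N + 1), ∑ k ∈ Finset.Icc (-(n : ℤ)) n, ∑ l ∈ Finset.Icc (-(n : ℤ)) n,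
        ∑ j ∈ Finset.Icc (-(n : ℤ)) n, F k j l n := by
    have hI (n : ℕ) (hn : n ∈ Finset.range (N + 1)) : Finset.Icc (-(n : ℤ)) n =
        {k ∈ Finset.Icc (-(N : ℤ)) N | k.natAbs ≤ n} := by
      ext k
      simp only [Finset.mem_range, Finset.mem_Icc, Finset.mem_filter] at *
      omega
    have h1 (n : ℕ) (hn : n ∈ Finset.range (N + 1)) :
        ∑ k ∈ Finset.Icc (-(n : ℤ)) n, ∑ l ∈ Finset.Icc (-(n : ℤ)) n,
          ∑ j ∈ Finset.Icc (-(n : ℤ)) n, F k j l n =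
        ∑ k ∈ Finset.Icc (-(N : ℤ)) N, ∑ j ∈ Finset.Icc (-(N : ℤ)) N,
          ∑ l ∈ Finset.Icc (-(N : ℤ)) N,
          (if k.natAbs ≤ n ∧ j.natAbs ≤ n ∧ l.natAbs ≤ n then F k j l n else 0) := by
      rw [hI n hn]
      simp only [Finset.sum_filter]
      refine Finset.sum_congr rfl fun k _ => ?_
      by_cases hk : k.natAbs ≤ n
      · simp only [hk, if_true, true_and]
        conv_rhs => rw [Finset.sum_comm]
        refine Finset.sum_congr rfl fun l _ => ?_
        by_cases hl : l.natAbs ≤ n <;> simp [hl]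
      · simp [hk]
    rw [Finset.sum_congr rfl h1]
    conv_rhs => rw [Finset.sum_comm]
    refine Finset.sum_congr rfl fun k _ => ?_
    conv_rhs => rw [Finset.sum_comm]
    refine Finset.sum_congr rfl fun j _ => ?_
    rw [Finset.sum_comm]
  rw [swap, harmonicSeries]
  refine Finset.sum_congr rfl fun n _ => ?_
  -- The harmonics carry `e^{-ikα}` and `e^{-ilγ}`, so both indices are negated to match the Fourier
  -- exponents.
  rw [sum_Icc_neg]
  refine Finset.sum_congr rfl fun k hk => ?_
  rw [sum_Icc_neg]
  refine Finset.sum_congr rfl fun l hl => ?_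
  rw [Finset.mem_Icc, ← abs_le] at hk hl
  rw [wignerD_euler_real (by rwa [abs_neg]) (by rwa [abs_neg]),
    wignerdTrig_neg_neg_eq_sum_exp hk hl]
  simp only [Finset.mul_sum, Finset.sum_mul]
  refine Finset.sum_congr rfl fun j _ => ?_
  rw [show Complex.I * (k * α + j * β + l * γ) = -Complex.I * (-k : ℤ) * α +
    j * (Complex.I * β) + -Complex.I * (-l : ℤ) * γ by push_cast; ring, Complex.exp_add,
    Complex.exp_add]
  ring

/-! ### Uniqueness of Fourier coefficients and injectivity of the Wigner transform. -/

/-- Dedekind's independence of characters, applied to the additive group of reals written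
multiplicatively. -/
theorem eq_zero_of_sum_exp_eq_zero {s : Finset ℤ} {c : ℤ → ℂ}
    (h : ∀ t : ℝ, ∑ k ∈ s, c k * Complex.exp (Complex.I * (k * t)) = 0) : ∀ k ∈ s, c k = 0 := by
  let χ : ℤ → (Multiplicative ℝ →* ℂ) := fun k =>
    { toFun := fun t => Complex.exp (Complex.I * (k * (Multiplicative.toAdd t : ℝ)))
      map_one' := by simp
      map_mul' := fun x y => by
        rw [← Complex.exp_add, toAdd_mul]; congr 1; push_cast; ring }
  have hχ : Function.Injective χ := by
    intro k l hkl
    by_contra hne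
    have hne' : (k - l : ℂ) ≠ 0 := by
      rw [sub_ne_zero]; exact_mod_cast hne
    -- At `t = π / (k - l)` the two characters have ratio `e^{iπ} = -1`.
    have h1 : Complex.exp (Complex.I * (k * (Real.pi / (k - l) : ℝ))) =
        Complex.exp (Complex.I * (l * (Real.pi / (k - l) : ℝ))) :=
      DFunLike.congr_fun hkl (Multiplicative.ofAdd (Real.pi / (k - l)))
    have h2 : Complex.exp (Complex.I * (k * (Real.pi / (k - l) : ℝ)) -
        Complex.I * (l * (Real.pi / (k - l) : ℝ))) = 1 := by
      rw [Complex.exp_sub, h1, div_self (Complex.exp_ne_zero _)]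
    rw [show Complex.I * (k * (Real.pi / (k - l) : ℝ)) -
        Complex.I * (l * (Real.pi / (k - l) : ℝ)) = Real.pi * Complex.I by
      push_cast; field_simp, Complex.exp_pi_mul_I] at h2
    norm_num at h2
  have hli := (linearIndependent_monoidHom (Multiplicative ℝ) ℂ).comp χ hχ
  rw [linearIndependent_iff'] at hli
  refine hli s c (funext fun t => ?_)
  simpa [χ] using h (Multiplicative.toAdd t)

theorem exp_triple (k j l : ℤ) (α β γ : ℝ) : Complex.exp (Complex.I * (k * α + j * β + l * γ)) =
    Complex.exp (Complex.I * (k * α)) * Complex.exp (Complex.I * (j * β)) *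
      Complex.exp (Complex.I * (l * γ)) := by
  rw [← Complex.exp_add, ← Complex.exp_add]; congr 1; ring

/-- Two trigonometric polynomials on the three-dimensional torus are equal if and only if their
coefficients are. -/
theorem forall_sum_exp_eq_iff {s : Finset ℤ} {c d : ℤ → ℤ → ℤ → ℂ} :
    (∀ α β γ : ℝ, ∑ k ∈ s, ∑ j ∈ s, ∑ l ∈ s,
        c k j l * Complex.exp (Complex.I * (k * α + j * β + l * γ)) =
      ∑ k ∈ s, ∑ j ∈ s, ∑ l ∈ s,
        d k j l * Complex.exp (Complex.I * (k * α + j * β + l * γ))) ↔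
    ∀ k ∈ s, ∀ j ∈ s, ∀ l ∈ s, c k j l = d k j l := by
  refine ⟨fun h k hk j hj l hl => sub_eq_zero.mp ?_, fun h α β γ => ?_⟩
  -- One variable at a time: the coefficients in `γ`, then in `β`, then in `α` are themselves the
  -- sums over the remaining indices.
  · refine eq_zero_of_sum_exp_eq_zero (c := fun l => c k j l - d k j l) (fun γ => ?_) l hl
    refine eq_zero_of_sum_exp_eq_zero (c := fun j => ∑ l ∈ s,
      (c k j l - d k j l) * Complex.exp (Complex.I * (l * γ))) (fun β => ?_) j hj
    refine eq_zero_of_sum_exp_eq_zero (c := fun k => ∑ j ∈ s, (∑ l ∈ s,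
      (c k j l - d k j l) * Complex.exp (Complex.I * (l * γ))) *
        Complex.exp (Complex.I * (j * β))) (fun α => ?_) k hk
    rw [← sub_eq_zero.mpr (h α β γ)]
    simp only [Finset.sum_mul, ← Finset.sum_sub_distrib]
    refine Finset.sum_congr rfl fun k _ => Finset.sum_congr rfl fun j _ =>
      Finset.sum_congr rfl fun l _ => ?_
    rw [exp_triple]; ring
  · exact Finset.sum_congr rfl fun k hk => Finset.sum_congr rfl fun j hj =>
      Finset.sum_congr rfl fun l hl => by rw [h k hk j hj l hl]

/-- The Wigner transform determines the harmonic coefficients. -/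
theorem wignerTransform_eq_iff {N : ℕ} {F G : ℕ → ℤ → ℤ → ℂ} :
    (∀ k ∈ Finset.Icc (-(N : ℤ)) N, ∀ j ∈ Finset.Icc (-(N : ℤ)) N,
      ∀ l ∈ Finset.Icc (-(N : ℤ)) N, wignerTransform N F k j l = wignerTransform N G k j l) ↔
    ∀ n : ℕ, n ≤ N → ∀ k ∈ Finset.Icc (-(n : ℤ)) n, ∀ l ∈ Finset.Icc (-(n : ℤ)) n,
      F n k l = G n k l := by
  refine ⟨fun h => ?_, fun h k _ j _ l _ => ?_⟩
  -- Downward induction on `n`, with `m = N - n`. At `j = n` only degrees `≥ n` enter the transform,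
  -- and those above `n` already agree.
  · suffices ∀ m n : ℕ, n + m = N → ∀ k ∈ Finset.Icc (-(n : ℤ)) n,
        ∀ l ∈ Finset.Icc (-(n : ℤ)) n, F n k l = G n k l from
      fun n hn => this (N - n) n (by omega)
    intro m
    induction m using Nat.strong_induction_on with
    | _ m ih =>
      intro n hn k hk l hl
      rw [Finset.mem_Icc] at hk hl
      have h1 := h (-k) (by rw [Finset.mem_Icc]; omega) n (by rw [Finset.mem_Icc]; omega) (-l)
        (by rw [Finset.mem_Icc]; omega)
      rw [wignerTransform, wignerTransform,
        mul_right_inj' (zpow_ne_zero _ Complex.I_ne_zero),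
        show max (-k).natAbs (max (-l).natAbs (n : ℤ).natAbs) = n by omega,
        ← Finset.add_sum_erase _ _ (Finset.left_mem_Icc.mpr (by omega : n ≤ N)),
        ← Finset.add_sum_erase _ _ (Finset.left_mem_Icc.mpr (by omega : n ≤ N))] at h1
      have h2 : ∀ i ∈ (Finset.Icc n N).erase n,
          (√(2 * i + 1 : ℝ) : ℂ) * (wignerd i n (-k) 0 : ℂ) * (wignerd i n (-l) 0 : ℂ) *
            F i (- -k) (- -l) =
          (√(2 * i + 1 : ℝ) : ℂ) * (wignerd i n (-k) 0 : ℂ) * (wignerd i n (-l) 0 : ℂ) *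
            G i (- -k) (- -l) := by
        intro i hi
        rw [Finset.mem_erase, Finset.mem_Icc] at hi
        rw [ih (N - i) (by omega) i (by omega) _ (by rw [Finset.mem_Icc]; omega) _
          (by rw [Finset.mem_Icc]; omega)]
      rw [Finset.sum_congr rfl h2, add_left_inj, neg_neg, neg_neg] at h1
      refine mul_left_cancel₀ (mul_ne_zero (mul_ne_zero ?_ ?_) ?_) h1
      · exact Complex.ofReal_ne_zero.mpr (by positivity)
      · exact Complex.ofReal_ne_zero.mpr
          (wignerd_zero_top_ne_zero (by rw [abs_neg, abs_le]; exact hk))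
      · exact Complex.ofReal_ne_zero.mpr
          (wignerd_zero_top_ne_zero (by rw [abs_neg, abs_le]; exact hl))
  · rw [wignerTransform, wignerTransform]
    congr 1
    refine Finset.sum_congr rfl fun n hn => ?_
    rw [Finset.mem_Icc] at hn
    rw [h n hn.2 _ (by rw [Finset.mem_Icc]; omega) _ (by rw [Finset.mem_Icc]; omega)]

/-! ### Truncation and reflection under the Wigner transform. -/

theorem wignerTransform_ite_left (N : ℕ) (F : ℕ → ℤ → ℤ → ℂ) (r : ℕ) (k j l : ℤ) :
    wignerTransform N (fun n k l => if k % (r : ℤ) ≠ 0 then 0 else F n k l) k j l =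
      if k % (r : ℤ) ≠ 0 then 0 else wignerTransform N F k j l := by
  have : (-k) % (r : ℤ) = 0 ↔ k % (r : ℤ) = 0 := by
    rw [← Int.dvd_iff_emod_eq_zero, ← Int.dvd_iff_emod_eq_zero, dvd_neg]
  simp only [wignerTransform, ne_eq, this]
  split_ifs <;> simp

theorem wignerTransform_ite_right (N : ℕ) (F : ℕ → ℤ → ℤ → ℂ) (r : ℕ) (k j l : ℤ) :
    wignerTransform N (fun n k l => if l % (r : ℤ) ≠ 0 then 0 else F n k l) k j l =
      if l % (r : ℤ) ≠ 0 then 0 else wignerTransform N F k j l := by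
  have : (-l) % (r : ℤ) = 0 ↔ l % (r : ℤ) = 0 := by
    rw [← Int.dvd_iff_emod_eq_zero, ← Int.dvd_iff_emod_eq_zero, dvd_neg]
  simp only [wignerTransform, ne_eq, this]
  split_ifs <;> simp

theorem neg_one_zpow_eq_I_zpow (m : ℤ) : (-1 : ℂ) ^ m = Complex.I ^ (2 * m) := by
  rw [zpow_mul]; simp [zpow_ofNat]

theorem I_zpow_add_four_mul (a b : ℤ) : Complex.I ^ (a + 4 * b) = Complex.I ^ a := by
  rw [zpow_add₀ Complex.I_ne_zero, zpow_mul]; simp [zpow_ofNat]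

/-- The parity `(-1) ^ (n + j)` of `wignerd n j k 0` under `k ↦ -k` absorbs `(-1) ^ n`, and the
change of `I ^ (k - l)` absorbs `(-1) ^ k`. What remains is `(-1) ^ j`, independent of the summation
index. -/
theorem wignerTransform_flip_left (N : ℕ) (F : ℕ → ℤ → ℤ → ℂ) (k j l : ℤ) :
    wignerTransform N (fun n k l => (-1) ^ ((n : ℤ) + k) * F n (-k) l) k j l =
      (-1) ^ j * wignerTransform N F (-k) j l := by
  simp only [wignerTransform, Int.natAbs_neg, Finset.mul_sum]
  refine Finset.sum_congr rfl fun n hn => ?_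
  rw [Finset.mem_Icc] at hn
  rw [wignerd_zero_neg_right (by rw [abs_le]; omega) (by rw [abs_le]; omega)]
  have : Complex.I ^ (k - l) * (-1) ^ ((n : ℤ) + -k) =
      (-1) ^ j * Complex.I ^ (-k - l) * (-1) ^ ((n : ℤ) + j) := by
    simp only [neg_one_zpow_eq_I_zpow, ← zpow_add₀ Complex.I_ne_zero]
    rw [← I_zpow_add_four_mul _ j]
    congr 1; ring
  push_cast
  linear_combination (↑√(2 * (n : ℝ) + 1) * (wignerd n j k 0 : ℂ) * (wignerd n j l 0 : ℂ) *
    F n (- -k) (-l)) * this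

theorem wignerTransform_flip_right (N : ℕ) (F : ℕ → ℤ → ℤ → ℂ) (k j l : ℤ) :
    wignerTransform N (fun n k l => (-1) ^ ((n : ℤ) + l) * F n k (-l)) k j l =
      (-1) ^ j * wignerTransform N F k j (-l) := by
  simp only [wignerTransform, Int.natAbs_neg, Finset.mul_sum]
  refine Finset.sum_congr rfl fun n hn => ?_
  rw [Finset.mem_Icc] at hn
  rw [wignerd_zero_neg_right (k := l) (by rw [abs_le]; omega) (by rw [abs_le]; omega)]
  have : Complex.I ^ (k - l) * (-1) ^ ((n : ℤ) + -l) =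
      (-1) ^ j * Complex.I ^ (k - -l) * (-1) ^ ((n : ℤ) + j) := by
    simp only [neg_one_zpow_eq_I_zpow, ← zpow_add₀ Complex.I_ne_zero]
    rw [← I_zpow_add_four_mul _ (j + l)]
    congr 1; ring
  push_cast
  linear_combination (↑√(2 * (n : ℝ) + 1) * (wignerd n j k 0 : ℂ) * (wignerd n j l 0 : ℂ) *
    F n (-k) (- -l)) * this

/-! ### Surjectivity of Euler angles and the action of rotations on them. -/

theorem exists_polar (x y : ℝ) : ∃ θ : ℝ, x = √(x ^ 2 + y ^ 2) * Real.cos θ ∧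
    y = √(x ^ 2 + y ^ 2) * Real.sin θ := by
  have h : ‖(⟨x, y⟩ : ℂ)‖ = √(x ^ 2 + y ^ 2) := Complex.norm_eq_sqrt_sq_add_sq _
  refine ⟨Complex.arg ⟨x, y⟩, ?_, ?_⟩
  · rw [← h, Complex.norm_mul_cos_arg]
  · rw [← h, Complex.norm_mul_sin_arg]

/-- A rotation which fixes the `z`-axis is a rotation about the `z`-axis. -/
theorem exists_eq_rotZ (Q : SO3) (h0 : Q.1 0 2 = 0) (h1 : Q.1 1 2 = 0) (h2 : Q.1 2 2 = 1) :
    ∃ γ, Q = rotZ γ := by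
  obtain ⟨A, hA⟩ := Q
  simp only at h0 h1 h2
  obtain ⟨ho, hd⟩ := Matrix.mem_specialOrthogonalGroup_iff.mp hA
  have ho' := (Matrix.mem_orthogonalGroup_iff _ _).mp ho
  have e (i j : Fin 3) := congrFun (congrFun ho' i) j
  simp only [Matrix.mul_apply, Fin.sum_univ_three, Matrix.transpose_apply] at e
  have e22 := e 2 2
  have e00 := e 0 0
  have e11 := e 1 1
  have e01 := e 0 1
  simp only [h0, h1, h2, Matrix.one_apply_eq] at e22 e00 e11
  rw [Matrix.one_apply_ne (by decide), h0, h1] at e01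
  have h20 : A 2 0 = 0 := by nlinarith [sq_nonneg (A 2 0), sq_nonneg (A 2 1)]
  have h21 : A 2 1 = 0 := by nlinarith [sq_nonneg (A 2 0), sq_nonneg (A 2 1)]
  rw [Matrix.det_fin_three, h0, h1, h2, h20, h21] at hd
  -- For the upper left block this is the sum of squared entries minus twice the determinant, that
  -- is `2 - 2`.
  have hs : (A 0 0 - A 1 1) ^ 2 + (A 0 1 + A 1 0) ^ 2 = 0 := by nlinarith
  have h3 : A 1 1 = A 0 0 := by nlinarith [sq_nonneg (A 0 0 - A 1 1), sq_nonneg (A 0 1 + A 1 0)]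
  have h4 : A 0 1 = -A 1 0 := by nlinarith [sq_nonneg (A 0 0 - A 1 1), sq_nonneg (A 0 1 + A 1 0)]
  obtain ⟨γ, hx, hy⟩ := exists_polar (A 0 0) (A 1 0)
  have hn : A 0 0 ^ 2 + A 1 0 ^ 2 = 1 := by rw [h4] at e00; nlinarith
  rw [hn, Real.sqrt_one, one_mul] at hx hy
  refine ⟨γ, Subtype.ext ?_⟩
  ext i j
  fin_cases i <;> fin_cases j <;> simp [rotZ, h0, h1, h2, h20, h21, h3, h4, ← hx, ← hy]

/-- The spherical coordinates `(β, α)` of the third column, the image of the `z`-axis, give two of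
the angles; undoing them leaves a rotation that fixes the `z`-axis. -/
theorem exists_eq_euler (R : SO3) : ∃ α β γ, R = euler α β γ := by
  have hn : R.1 0 2 ^ 2 + R.1 1 2 ^ 2 + R.1 2 2 ^ 2 = 1 := by
    have h := (Matrix.mem_orthogonalGroup_iff' _ _).mp
      (Matrix.mem_specialOrthogonalGroup_iff.mp R.2).1
    have h22 := congrFun (congrFun h 2) 2
    simp only [Matrix.mul_apply, Fin.sum_univ_three, Matrix.transpose_apply,
      Matrix.one_apply_eq] at h22
    linarith
  obtain ⟨α, hx, hy⟩ := exists_polar (R.1 0 2) (R.1 1 2)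
  obtain ⟨ρ, hρ⟩ : ∃ ρ, √(R.1 0 2 ^ 2 + R.1 1 2 ^ 2) = ρ := ⟨_, rfl⟩
  have hρ2 : ρ ^ 2 = R.1 0 2 ^ 2 + R.1 1 2 ^ 2 := by
    rw [← hρ, Real.sq_sqrt (by positivity)]
  rw [hρ] at hx hy
  obtain ⟨β, hz, hr⟩ := exists_polar (R.1 2 2) ρ
  rw [show R.1 2 2 ^ 2 + ρ ^ 2 = 1 by linarith, Real.sqrt_one, one_mul] at hz hr
  have hα := Real.sin_sq_add_cos_sq α
  have hβ := Real.sin_sq_add_cos_sq β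
  have hval (i : Fin 3) : (rotY (-β) * (rotZ (-α) * R)).1 i 2 =
      ∑ a, (rotY (-β)).1 i a * ∑ b, (rotZ (-α)).1 a b * R.1 b 2 := rfl
  obtain ⟨γ, hγ⟩ := exists_eq_rotZ (rotY (-β) * (rotZ (-α) * R))
    (by
      rw [hval]
      simp [rotY, rotZ, Fin.sum_univ_three]
      rw [hx, hy, hz, hr]; linear_combination (Real.cos β * Real.sin β) * hα)
    (by
      rw [hval]
      simp [rotY, rotZ, Fin.sum_univ_three]
      rw [hx, hy]; ring)
    (by
      rw [hval]
      simp [rotY, rotZ, Fin.sum_univ_three]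
      rw [hx, hy, hz, hr]; linear_combination (Real.sin β ^ 2) * hα + hβ)
  have hY : rotY β * rotY (-β) = 1 := by
    apply Subtype.ext
    change (rotY β).1 * (rotY (-β)).1 = 1
    ext i j
    fin_cases i <;> fin_cases j <;>
      simp [rotY, Matrix.mul_apply, Fin.sum_univ_three] <;> nlinarith
  have hZ : rotZ α * rotZ (-α) = 1 := by
    apply Subtype.ext
    change (rotZ α).1 * (rotZ (-α)).1 = 1
    ext i j
    fin_cases i <;> fin_cases j <;>
      simp [rotZ, Matrix.mul_apply, Fin.sum_univ_three] <;> nlinarith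
  refine ⟨α, β, γ, ?_⟩
  rw [euler, ← hγ, mul_assoc, ← mul_assoc (rotY β), hY, one_mul, ← mul_assoc, hZ, one_mul]

theorem rotZ_add (s t : ℝ) : rotZ (s + t) = rotZ s * rotZ t := by
  apply Subtype.ext
  change (rotZ (s + t)).1 = (rotZ s).1 * (rotZ t).1
  ext i j
  fin_cases i <;> fin_cases j <;>
    simp [rotZ, Matrix.mul_apply, Fin.sum_univ_three, Real.cos_add, Real.sin_add] <;> ring

theorem rotY_add (s t : ℝ) : rotY (s + t) = rotY s * rotY t := by
  apply Subtype.ext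
  change (rotY (s + t)).1 = (rotY s).1 * (rotY t).1
  ext i j
  fin_cases i <;> fin_cases j <;>
    simp [rotY, Matrix.mul_apply, Fin.sum_univ_three, Real.cos_add, Real.sin_add] <;> ring

theorem rotZ_zero : rotZ 0 = 1 := by
  apply Subtype.ext
  ext i j
  fin_cases i <;> fin_cases j <;> simp [rotZ]

theorem rotY_zero : rotY 0 = 1 := by
  apply Subtype.ext
  ext i j
  fin_cases i <;> fin_cases j <;> simp [rotY]

/-- A half turn about the `y`-axis reverses the `z`-axis. Moving `rotY π` past the outer factor of
`euler` therefore negates that angle and shifts `β` by `π`. -/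
theorem rotY_pi_mul_rotZ (t : ℝ) : rotY Real.pi * rotZ t = rotZ (-t) * rotY Real.pi := by
  apply Subtype.ext
  change (rotY Real.pi).1 * (rotZ t).1 = (rotZ (-t)).1 * (rotY Real.pi).1
  ext i j
  fin_cases i <;> fin_cases j <;> simp [rotY, rotZ, Matrix.mul_apply, Fin.sum_univ_three]

theorem rotZ_mul_rotY_pi (t : ℝ) : rotZ t * rotY Real.pi = rotY Real.pi * rotZ (-t) := by
  rw [rotY_pi_mul_rotZ, neg_neg]

theorem rotZ_mul_euler (t α β γ : ℝ) : rotZ t * euler α β γ = euler (t + α) β γ := by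
  simp only [euler, rotZ_add, mul_assoc]

theorem euler_mul_rotZ (t α β γ : ℝ) : euler α β γ * rotZ t = euler α β (γ + t) := by
  simp only [euler, rotZ_add, mul_assoc]

theorem rotY_pi_mul_euler (α β γ : ℝ) :
    rotY Real.pi * euler α β γ = euler (-α) (Real.pi + β) γ := by
  rw [euler, ← mul_assoc, ← mul_assoc, rotY_pi_mul_rotZ, euler, rotY_add]
  simp only [mul_assoc]

theorem euler_mul_rotY_pi (α β γ : ℝ) :
    euler α β γ * rotY Real.pi = euler α (β + Real.pi) (-γ) := by
  rw [euler, mul_assoc, rotZ_mul_rotY_pi, euler, rotY_add]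
  simp only [mul_assoc]

theorem mem_rightSymmetryGroup_iff (f : SO3 → ℂ) (s : SO3) :
    s ∈ rightSymmetryGroup f ↔ ∀ α β γ : ℝ, f (s * euler α β γ) = f (euler α β γ) := by
  refine ⟨fun h α β γ => h _, fun h R => ?_⟩
  obtain ⟨α, β, γ, rfl⟩ := exists_eq_euler R
  exact h α β γ

theorem mem_leftSymmetryGroup_iff (f : SO3 → ℂ) (s : SO3) :
    s ∈ leftSymmetryGroup f ↔ ∀ α β γ : ℝ, f (euler α β γ * s) = f (euler α β γ) := by
  refine ⟨fun h α β γ => h _, fun h R => ?_⟩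
  obtain ⟨α, β, γ, rfl⟩ := exists_eq_euler R
  exact h α β γ

/-! ### Symmetries as conditions on Fourier coefficients. -/

/-- `g` consists of the Fourier coefficients, up to degree `N`, of the function `f` pulled back to
the torus along the Euler angle parametrization. -/
def IsFourierSeries (N : ℕ) (f : SO3 → ℂ) (g : ℤ → ℤ → ℤ → ℂ) : Prop :=
  ∀ α β γ : ℝ, f (euler α β γ) =
    ∑ k ∈ Finset.Icc (-(N : ℤ)) N, ∑ j ∈ Finset.Icc (-(N : ℤ)) N, ∑ l ∈ Finset.Icc (-(N : ℤ)) N,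
      g k j l * Complex.exp (Complex.I * (k * α + j * β + l * γ))

theorem exp_I_mul_pi (j : ℤ) : Complex.exp (Complex.I * (j * Real.pi)) = (-1) ^ j := by
  rw [show Complex.I * (j * Real.pi) = j * (Real.pi * Complex.I) by ring, Complex.exp_int_mul,
    Complex.exp_pi_mul_I]

variable {N : ℕ} {f : SO3 → ℂ} {g : ℤ → ℤ → ℤ → ℂ}

theorem IsFourierSeries.rotZ_mem_right_iff (hf : IsFourierSeries N f g) (t : ℝ) :
    rotZ t ∈ rightSymmetryGroup f ↔ ∀ k ∈ Finset.Icc (-(N : ℤ)) N,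
      ∀ j ∈ Finset.Icc (-(N : ℤ)) N, ∀ l ∈ Finset.Icc (-(N : ℤ)) N,
        Complex.exp (Complex.I * (k * t)) * g k j l = g k j l := by
  rw [mem_rightSymmetryGroup_iff, ← forall_sum_exp_eq_iff]
  refine forall_congr' fun α => forall_congr' fun β => forall_congr' fun γ => ?_
  rw [rotZ_mul_euler, hf, hf]
  refine Eq.congr_left (Finset.sum_congr rfl fun k _ => Finset.sum_congr rfl fun j _ =>
    Finset.sum_congr rfl fun l _ => ?_)
  rw [show Complex.I * (k * ((t + α : ℝ) : ℂ) + j * β + l * γ) = Complex.I * (k * t) +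
    Complex.I * (k * α + j * β + l * γ) by push_cast; ring, Complex.exp_add]
  ring

theorem IsFourierSeries.rotZ_mem_left_iff (hf : IsFourierSeries N f g) (t : ℝ) :
    rotZ t ∈ leftSymmetryGroup f ↔ ∀ k ∈ Finset.Icc (-(N : ℤ)) N,
      ∀ j ∈ Finset.Icc (-(N : ℤ)) N, ∀ l ∈ Finset.Icc (-(N : ℤ)) N,
        Complex.exp (Complex.I * (l * t)) * g k j l = g k j l := by
  rw [mem_leftSymmetryGroup_iff, ← forall_sum_exp_eq_iff]
  refine forall_congr' fun α => forall_congr' fun β => forall_congr' fun γ => ?_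
  rw [euler_mul_rotZ, hf, hf]
  refine Eq.congr_left (Finset.sum_congr rfl fun k _ => Finset.sum_congr rfl fun j _ =>
    Finset.sum_congr rfl fun l _ => ?_)
  rw [show Complex.I * (k * α + j * β + l * ((γ + t : ℝ) : ℂ)) = Complex.I * (l * t) +
    Complex.I * (k * α + j * β + l * γ) by push_cast; ring, Complex.exp_add]
  ring

theorem IsFourierSeries.rotY_pi_mem_right_iff (hf : IsFourierSeries N f g) :
    rotY Real.pi ∈ rightSymmetryGroup f ↔ ∀ k ∈ Finset.Icc (-(N : ℤ)) N,
      ∀ j ∈ Finset.Icc (-(N : ℤ)) N, ∀ l ∈ Finset.Icc (-(N : ℤ)) N,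
        (-1) ^ j * g (-k) j l = g k j l := by
  rw [mem_rightSymmetryGroup_iff, ← forall_sum_exp_eq_iff]
  refine forall_congr' fun α => forall_congr' fun β => forall_congr' fun γ => ?_
  rw [rotY_pi_mul_euler, hf, hf, sum_Icc_neg]
  refine Eq.congr_left (Finset.sum_congr rfl fun k _ => Finset.sum_congr rfl fun j _ =>
    Finset.sum_congr rfl fun l _ => ?_)
  rw [show Complex.I * ((-k : ℤ) * ((-α : ℝ) : ℂ) + j * ((Real.pi + β : ℝ) : ℂ) + l * γ) =
    Complex.I * (j * Real.pi) + Complex.I * (k * α + j * β + l * γ) by push_cast; ring,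
    Complex.exp_add, exp_I_mul_pi]
  ring

theorem IsFourierSeries.rotY_pi_mem_left_iff (hf : IsFourierSeries N f g) :
    rotY Real.pi ∈ leftSymmetryGroup f ↔ ∀ k ∈ Finset.Icc (-(N : ℤ)) N,
      ∀ j ∈ Finset.Icc (-(N : ℤ)) N, ∀ l ∈ Finset.Icc (-(N : ℤ)) N,
        (-1) ^ j * g k j (-l) = g k j l := by
  rw [mem_leftSymmetryGroup_iff, ← forall_sum_exp_eq_iff]
  refine forall_congr' fun α => forall_congr' fun β => forall_congr' fun γ => ?_
  rw [euler_mul_rotY_pi, hf, hf]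
  refine Eq.congr_left (Finset.sum_congr rfl fun k _ => Finset.sum_congr rfl fun j _ => ?_)
  rw [sum_Icc_neg]
  refine Finset.sum_congr rfl fun l _ => ?_
  rw [show Complex.I * (k * α + j * ((β + Real.pi : ℝ) : ℂ) + (-l : ℤ) * ((-γ : ℝ) : ℂ)) =
    Complex.I * (j * Real.pi) + Complex.I * (k * α + j * β + l * γ) by push_cast; ring,
    Complex.exp_add, exp_I_mul_pi]
  ring

theorem exp_two_pi_mul_div_eq_one {r : ℕ} (hr : 0 < r) {k : ℤ} (h : k % (r : ℤ) = 0) (s : ℕ) :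
    Complex.exp (Complex.I * (k * (2 * Real.pi * s / r : ℝ))) = 1 := by
  obtain ⟨m, rfl⟩ := Int.dvd_of_emod_eq_zero h
  rw [Complex.exp_eq_one_iff]
  refine ⟨m * s, ?_⟩
  have : (r : ℂ) ≠ 0 := by exact_mod_cast hr.ne'
  push_cast
  field_simp

theorem emod_eq_zero_of_exp_eq_one {r : ℕ} (hr : 0 < r) {k : ℤ}
    (h : Complex.exp (Complex.I * (k * (2 * Real.pi * (1 : ℕ) / r : ℝ))) = 1) :
    k % (r : ℤ) = 0 := by
  obtain ⟨m, hm⟩ := Complex.exp_eq_one_iff.mp h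
  have hr' : (r : ℂ) ≠ 0 := by exact_mod_cast hr.ne'
  have hpi : (Real.pi : ℂ) ≠ 0 := Complex.ofReal_ne_zero.mpr Real.pi_ne_zero
  have hI := Complex.I_ne_zero
  push_cast at hm
  field_simp at hm
  have : k = r * m := by exact_mod_cast hm
  rw [this, Int.mul_emod_right]

/-- If membership of the rotations about the `z`-axis in a set `S` is governed by the phases of a
coefficient family, then membership of `C_r` means that the coefficients of index not divisible
by `r` vanish. -/
theorem cyclicSet_subset_iff {ι : Type*} {S : Set SO3} {κ : ι → ℤ} {c : ι → ℂ}
    (hS : ∀ t : ℝ, rotZ t ∈ S ↔ ∀ i, Complex.exp (Complex.I * (κ i * t)) * c i = c i)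
    {r : ℕ} (hr : 0 < r) :
    cyclicSet r ⊆ S ↔ ∀ i, κ i % (r : ℤ) ≠ 0 → c i = 0 := by
  constructor
  · intro h i hi
    -- The element with `s = 1` is listed in `cyclicSet r` only for `r > 1`; for `r = 1` no index is
    -- nondivisible.
    have hr1 : 1 < r := by
      by_contra hle
      obtain rfl : r = 1 := by omega
      exact hi (Int.emod_one _)
    have h1 := (hS _).mp (h ⟨1, hr1, rfl⟩) i
    by_contra hc
    exact hi (emod_eq_zero_of_exp_eq_one hr (mul_eq_right₀ hc |>.mp h1))
  · rintro h _ ⟨s, -, rfl⟩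
    refine (hS _).mpr fun i => ?_
    by_cases hi : κ i % (r : ℤ) = 0
    · rw [exp_two_pi_mul_div_eq_one hr hi, one_mul]
    · rw [h i hi, mul_zero]

theorem dihedralSet_subset_iff (S : Subgroup SO3) {r : ℕ} (hr : 0 < r) :
    dihedralSet r ⊆ (S : Set SO3) ↔ cyclicSet r ⊆ (S : Set SO3) ∧ rotY Real.pi ∈ S := by
  constructor
  · refine fun h => ⟨fun c hc => h ⟨c, hc, 0, by norm_num, ?_⟩,
      h ⟨1, ⟨0, hr, ?_⟩, 1, by norm_num, ?_⟩⟩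
    · simp [rotY_zero]
    · simp [rotZ_zero]
    · simp
  · rintro ⟨hC, hY⟩ _ ⟨c, hc, s, hs, rfl⟩
    refine S.mul_mem (hC hc) ?_
    interval_cases s
    · simp [rotY_zero, S.one_mem]
    · simpa using hY

theorem IsFourierSeries.cyclicSet_subset_right_iff (hf : IsFourierSeries N f g) {r : ℕ}
    (hr : 0 < r) : cyclicSet r ⊆ (rightSymmetryGroup f : Set SO3) ↔
      ∀ k ∈ Finset.Icc (-(N : ℤ)) N, ∀ j ∈ Finset.Icc (-(N : ℤ)) N,
        ∀ l ∈ Finset.Icc (-(N : ℤ)) N, k % (r : ℤ) ≠ 0 → g k j l = 0 := by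
  let I := Finset.Icc (-(N : ℤ)) N
  rw [cyclicSet_subset_iff (ι := I × I × I) (κ := fun x => x.1)
    (c := fun x => g x.1 x.2.1 x.2.2) (fun t => by
      rw [SetLike.mem_coe, hf.rotZ_mem_right_iff]; simp [I, Prod.forall, Subtype.forall]) hr]
  simp [I, Prod.forall, Subtype.forall]

theorem IsFourierSeries.cyclicSet_subset_left_iff (hf : IsFourierSeries N f g) {r : ℕ}
    (hr : 0 < r) : cyclicSet r ⊆ (leftSymmetryGroup f : Set SO3) ↔
      ∀ k ∈ Finset.Icc (-(N : ℤ)) N, ∀ j ∈ Finset.Icc (-(N : ℤ)) N,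
        ∀ l ∈ Finset.Icc (-(N : ℤ)) N, l % (r : ℤ) ≠ 0 → g k j l = 0 := by
  let I := Finset.Icc (-(N : ℤ)) N
  rw [cyclicSet_subset_iff (ι := I × I × I) (κ := fun x => x.2.2)
    (c := fun x => g x.1 x.2.1 x.2.2) (fun t => by
      rw [SetLike.mem_coe, hf.rotZ_mem_left_iff]; simp [I, Prod.forall, Subtype.forall]) hr]
  simp [I, Prod.forall, Subtype.forall]

/-- Transfer of a linear condition between the harmonic coefficients and their Wigner transform. -/
theorem harmonic_eq_iff_wigner_eq {N : ℕ} {F G : ℕ → ℤ → ℤ → ℂ} {g h : ℤ → ℤ → ℤ → ℂ}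
    (hg : ∀ k ∈ Finset.Icc (-(N : ℤ)) N, ∀ j ∈ Finset.Icc (-(N : ℤ)) N,
      ∀ l ∈ Finset.Icc (-(N : ℤ)) N, g k j l = wignerTransform N F k j l)
    (hh : ∀ k ∈ Finset.Icc (-(N : ℤ)) N, ∀ j ∈ Finset.Icc (-(N : ℤ)) N,
      ∀ l ∈ Finset.Icc (-(N : ℤ)) N, h k j l = wignerTransform N G k j l) :
    (∀ n : ℕ, n ≤ N → ∀ k ∈ Finset.Icc (-(n : ℤ)) n, ∀ l ∈ Finset.Icc (-(n : ℤ)) n,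
      F n k l = G n k l) ↔
    ∀ k ∈ Finset.Icc (-(N : ℤ)) N, ∀ j ∈ Finset.Icc (-(N : ℤ)) N,
      ∀ l ∈ Finset.Icc (-(N : ℤ)) N, g k j l = h k j l := by
  rw [← wignerTransform_eq_iff]
  refine forall₂_congr fun k hk => forall₂_congr fun j hj => forall₂_congr fun l hl => ?_
  rw [hg k hk j hj l hl, hh k hk j hj l hl]

theorem neg_mem_Icc {n : ℕ} {k : ℤ} (hk : k ∈ Finset.Icc (-(n : ℤ)) n) :
    -k ∈ Finset.Icc (-(n : ℤ)) n := by
  rw [Finset.mem_Icc] at *; omega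

theorem eq_ite_zero_iff {p : Prop} [Decidable p] (z : ℂ) :
    z = (if p then 0 else z) ↔ (p → z = 0) := by
  split_ifs with h <;> simp [h]

end DFS

end

/-! ### The four equivalences. -/

theorem mainTheorem6 (N : ℕ) (f : DFS.SO3 → ℂ) (fhat : ℕ → ℤ → ℤ → ℂ)
    (hf : ∀ R : DFS.SO3, f R = DFS.harmonicSeries N fhat R)
    (ghat : ℤ → ℤ → ℤ → ℂ)
    (hg : ∀ k ∈ Finset.Icc (-(N : ℤ)) N, ∀ j ∈ Finset.Icc (-(N : ℤ)) N,
      ∀ l ∈ Finset.Icc (-(N : ℤ)) N, ghat k j l = DFS.wignerTransform N fhat k j l)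
    (r : ℕ) (hr : 0 < r) :
    -- `ghat` consists of the Fourier coefficients of the DFS transform of `f`
    (∀ α β γ : ℝ, f (DFS.euler α β γ) =
      ∑ k ∈ Finset.Icc (-(N : ℤ)) N, ∑ j ∈ Finset.Icc (-(N : ℤ)) N,
        ∑ l ∈ Finset.Icc (-(N : ℤ)) N,
          ghat k j l * Complex.exp (Complex.I * (k * α + j * β + l * γ))) ∧
    -- a)
    List.TFAE [
      DFS.cyclicSet r ⊆ (DFS.rightSymmetryGroup f : Set DFS.SO3),
      ∀ n : ℕ, n ≤ N → ∀ k ∈ Finset.Icc (-(n : ℤ)) n, ∀ l ∈ Finset.Icc (-(n : ℤ)) n,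
        k % (r : ℤ) ≠ 0 → fhat n k l = 0,
      ∀ k ∈ Finset.Icc (-(N : ℤ)) N, ∀ j ∈ Finset.Icc (-(N : ℤ)) N,
        ∀ l ∈ Finset.Icc (-(N : ℤ)) N, k % (r : ℤ) ≠ 0 → ghat k j l = 0] ∧
    -- b)
    List.TFAE [
      DFS.dihedralSet r ⊆ (DFS.rightSymmetryGroup f : Set DFS.SO3),
      ∀ n : ℕ, n ≤ N → ∀ k ∈ Finset.Icc (-(n : ℤ)) n, ∀ l ∈ Finset.Icc (-(n : ℤ)) n,
        (k % (r : ℤ) ≠ 0 → fhat n k l = 0) ∧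
          fhat n k l = (-1 : ℂ) ^ ((n : ℤ) + k) * fhat n (-k) l,
      ∀ k ∈ Finset.Icc (-(N : ℤ)) N, ∀ j ∈ Finset.Icc (-(N : ℤ)) N,
        ∀ l ∈ Finset.Icc (-(N : ℤ)) N, (k % (r : ℤ) ≠ 0 → ghat k j l = 0) ∧
          ghat k j l = (-1 : ℂ) ^ j * ghat (-k) j l] ∧
    -- c)
    List.TFAE [
      DFS.cyclicSet r ⊆ (DFS.leftSymmetryGroup f : Set DFS.SO3),
      ∀ n : ℕ, n ≤ N → ∀ k ∈ Finset.Icc (-(n : ℤ)) n, ∀ l ∈ Finset.Icc (-(n : ℤ)) n,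
        l % (r : ℤ) ≠ 0 → fhat n k l = 0,
      ∀ k ∈ Finset.Icc (-(N : ℤ)) N, ∀ j ∈ Finset.Icc (-(N : ℤ)) N,
        ∀ l ∈ Finset.Icc (-(N : ℤ)) N, l % (r : ℤ) ≠ 0 → ghat k j l = 0] ∧
    -- d)
    List.TFAE [
      DFS.dihedralSet r ⊆ (DFS.leftSymmetryGroup f : Set DFS.SO3),
      ∀ n : ℕ, n ≤ N → ∀ k ∈ Finset.Icc (-(n : ℤ)) n, ∀ l ∈ Finset.Icc (-(n : ℤ)) n,
        (l % (r : ℤ) ≠ 0 → fhat n k l = 0) ∧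
          fhat n k l = (-1 : ℂ) ^ ((n : ℤ) + l) * fhat n k (-l),
      ∀ k ∈ Finset.Icc (-(N : ℤ)) N, ∀ j ∈ Finset.Icc (-(N : ℤ)) N,
        ∀ l ∈ Finset.Icc (-(N : ℤ)) N, (l % (r : ℤ) ≠ 0 → ghat k j l = 0) ∧
          ghat k j l = (-1 : ℂ) ^ j * ghat k j (-l)] := by
  obtain rfl : f = DFS.harmonicSeries N fhat := funext hf
  have hF : DFS.IsFourierSeries N (DFS.harmonicSeries N fhat) ghat := by
    intro α β γ
    rw [DFS.harmonicSeries_euler]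
    exact Finset.sum_congr rfl fun k hk => Finset.sum_congr rfl fun j hj =>
      Finset.sum_congr rfl fun l hl => by rw [hg k hk j hj l hl]
  -- Vanishing off the multiples of `r` is expressed as equality with the truncated family, so that
  -- injectivity of the transform applies; `eq_ite_zero_iff` converts back.
  have cyc_right := DFS.harmonic_eq_iff_wigner_eq hg
    (h := fun k j l => if k % (r : ℤ) ≠ 0 then 0 else ghat k j l)
    (fun k hk j hj l hl => by rw [DFS.wignerTransform_ite_left N fhat r, hg k hk j hj l hl])
  have cyc_left := DFS.harmonic_eq_iff_wigner_eq hg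
    (h := fun k j l => if l % (r : ℤ) ≠ 0 then 0 else ghat k j l)
    (fun k hk j hj l hl => by rw [DFS.wignerTransform_ite_right N fhat r, hg k hk j hj l hl])
  simp only [DFS.eq_ite_zero_iff] at cyc_right cyc_left
  have flip_right := DFS.harmonic_eq_iff_wigner_eq hg
    (h := fun k j l => (-1) ^ j * ghat (-k) j l)
    (fun k hk j hj l hl => by
      rw [DFS.wignerTransform_flip_left N fhat, hg _ (DFS.neg_mem_Icc hk) j hj l hl])
  have flip_left := DFS.harmonic_eq_iff_wigner_eq hg
    (h := fun k j l => (-1) ^ j * ghat k j (-l))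
    (fun k hk j hj l hl => by
      rw [DFS.wignerTransform_flip_right N fhat, hg k hk j hj _ (DFS.neg_mem_Icc hl)])
  refine ⟨hF, ?_, ?_, ?_, ?_⟩
  · tfae_have 1 ↔ 3 := hF.cyclicSet_subset_right_iff hr
    tfae_have 2 ↔ 3 := cyc_right
    tfae_finish
  · tfae_have 1 ↔ 3 := by
      rw [DFS.dihedralSet_subset_iff _ hr, hF.cyclicSet_subset_right_iff hr,
        hF.rotY_pi_mem_right_iff]
      simp only [forall_and, eq_comm]
    tfae_have 2 ↔ 3 := by
      simp only [forall_and]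
      exact and_congr cyc_right flip_right
    tfae_finish
  · tfae_have 1 ↔ 3 := hF.cyclicSet_subset_left_iff hr
    tfae_have 2 ↔ 3 := cyc_left
    tfae_finish
  · tfae_have 1 ↔ 3 := by
      rw [DFS.dihedralSet_subset_iff _ hr, hF.cyclicSet_subset_left_iff hr,
        hF.rotY_pi_mem_left_iff]
      simp only [forall_and, eq_comm]
    tfae_have 2 ↔ 3 := by
      simp only [forall_and]
      exact and_congr cyc_left flip_left
    tfae_finish
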